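/- Let $(\mathcal X,\rho)$ be a metric space, $\mathbb P$ a Borel probability measure on $\mathcal X\times\{0,1\}$ whose marginal $\mu$ on $\mathcal X$ has full support, and $\eta:\mathcal X\to[0,1]$ a measurable version of $\eta(x)=\mathbb P(Y=1\mid X=x)$. For $S\subseteq\mathcal X$ with $\mu(S)>0$ put $\eta(S)=\frac1{\mu(S)}\int_S\eta\,d\mu$. Let $B(x,r)$, $B^o(x,r)$ be closed and open balls, and $r(x;p)=\inf\{r\ge 0:\mu(B(x,r))\ge p\}$ (with $\inf\emptyset=\infty$). For $x'\in\mathcal X$, $r'\ge0$, $z'\in[0,1]$ let $$B'(x',r',z')=\{(x,z)\in\mathcal X\times[0,1]:\ \rho(x,x')<r'\ \text{ or }\ (\rho(x,x')=r'\text{ and }z<z')\},$$ and assume that the family of all such sets has finite VC-dimension $d$. For $p,\Delta$ the effective decision boundary $\partial_{p,\Delta}$ is the complement of $\mathcal X^+_{p,\Delta}\cup\mathcal X^-_{p,\Delta}$, where $\mathcal X^+_{p,\Delta}$ (resp. $\mathcal X^-_{p,\Delta}$) is the set of $x$ with $\eta(x)>\frac12$ (resp. $\eta(x)<\frac12$)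 such that $\eta(B(x,r))-\frac12\ge\Delta$ (resp. $\frac12-\eta(B(x,r))\ge\Delta$) for all $0\le r\le r(x;p)$, $r<\infty$, with $\mu(B(x,r))>0$. Draw $(X_1,Y_1),\dots,(X_n,Y_n)$ i.i.d. from $\mathbb P$, together with independent tie-breaking variables $Z_i$ uniform on $[0,1]$; let $Y_{(i)}(x)$ be the label of the $i$-th nearest neighbour of $x$ among $X_1,\dots,X_n$, where ties in distance go to the lower $Z$. For $\delta\in(0,1)$ and integers $1\le k<n$, with constants $c_0,c_2$, set $$c_\delta=\frac{1}{1-\sqrt{(4/k)\log(2/\delta)}},\qquad \Delta=\min\Big(\tfrac12,\sqrt{\tfrac{\log(2/\delta)}{k}}\Big),\qquad \Delta_{\mathrm{UC}}=c_0\sqrt{\frac{d\log n+\log(1/\delta)}{k}},$$ $$\hat{\mathscr H}_{n,k}=\Big\{x\in\mathcal X:\ \Big|\frac1k\sum_{i=1}^kY_{(i)}(x)-\frac12\Big|<3\Delta_{\mathrm{UC}}\Big\}$$ (read $c_\delta=0$ if its denominator vanishes). Lemma. There are universal constants $c_0,c_2>0$ such that the following holds for all $(\mathcal X,\rho,\mathbb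 P,\eta)$ as above, all integers $1\le k<n$, all $\delta\in(0,1)$ and all $\alpha,L>0$. If $\eta$ is $(\alpha,L)$-smooth, i.e. $|\eta(x)-\eta(x')|\le L\,\mu\big(B^o(x,\rho(x,x'))\big)^\alpha$ for all $x,x'\in\mathcal X$, and $$2L\Big(\frac kn+c_2\sqrt{\frac{d+\log(1/\delta)}{n}}\Big)^\alpha\le\Delta_{\mathrm{UC}},$$ then with probability at least $1-\delta^2/16$ over the sample, $$\partial_{c_\delta k/n,\,\Delta}\subseteq\hat{\mathscr H}_{n,k}.$$ -/

import Mathlib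

open MeasureTheory
open scoped ENNReal NNReal

noncomputable section

namespace ActiveKNN

section VC

/-- The set family `𝒞` shatters the finite set `A`: it cuts out every subset of `A`. -/
def Shatters {β : Type*} (𝒞 : Set (Set β)) (A : Finset β) : Prop :=
  ∀ T ⊆ (A : Set β), ∃ C ∈ 𝒞, (A : Set β) ∩ C = T

/-- The VC-dimension of a (possibly infinite) family of sets: the supremum of the sizes of the
finite sets it shatters. -/
def vcDim {β : Type*} (𝒞 : Set (Set β)) : ℕ∞ :=
  ⨆ (A : Finset β) (_ : Shatters 𝒞 A), (A.card : ℕ∞)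

end VC

section Space

variable {X : Type*} [MetricSpace X]

/-- The augmented ball `B'(x', r', z')` in `X × [0,1]`. -/
def augBall (x' : X) (r' : ℝ) (z' : unitInterval) : Set (X × unitInterval) :=
  {p | dist p.1 x' < r' ∨ (dist p.1 x' = r' ∧ p.2 < z')}

variable (X) in
/-- The family of all augmented balls (of radius `≥ 0`). -/
def augBalls : Set (Set (X × unitInterval)) :=
  {B | ∃ (x' : X) (r' : ℝ) (z' : unitInterval), 0 ≤ r' ∧ B = augBall x' r' z'}

variable [MeasurableSpace X]

/-- `η` is a conditional probability function of `P`, i.e. `η x = P(Y = 1 | X = x)`, with label `1`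
encoded as `true` and `P.fst` the marginal of `P` on the instance space. -/
structure IsCondProb (P : Measure (X × Bool)) (η : X → ℝ) : Prop where
  measurable : Measurable η
  mem_Icc : ∀ x, η x ∈ Set.Icc (0 : ℝ) 1
  lintegral_eq : ∀ A : Set X, MeasurableSet A →
    P (A ×ˢ {true}) = ∫⁻ x in A, ENNReal.ofReal (η x) ∂P.fst

/-- `(α, L)`-smoothness of `η` in `(X, dist, μ)`. -/
def IsSmooth (μ : Measure X) (η : X → ℝ) (α L : ℝ) : Prop :=
  ∀ x x' : X, |η x - η x'| ≤ L * (μ.real (Metric.ball x (dist x x'))) ^ α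

/-- The probability radius `r(x; p)`, an infimum in `[0, ∞]`
(it is `∞` if no closed ball about `x` has mass at least `p`). -/
def probRadius (μ : Measure X) (x : X) (p : ℝ) : ℝ≥0∞ :=
  ⨅ (r : ℝ≥0) (_ : p ≤ μ.real (Metric.closedBall x r)), (r : ℝ≥0∞)

/-- The positive part of the effective interior. `η(B(x, r))` is the average of `η` over the closed
ball, defined only when that ball has positive mass. -/
def effInteriorPos (μ : Measure X) (η : X → ℝ) (p Δ : ℝ) : Set X :=
  {x | 1 / 2 < η x ∧ ∀ r : ℝ≥0, (r : ℝ≥0∞) ≤ probRadius μ x p →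
    0 < μ (Metric.closedBall x r) → Δ ≤ (⨍ y in Metric.closedBall x r, η y ∂μ) - 1 / 2}

/-- The negative part of the effective interior. -/
def effInteriorNeg (μ : Measure X) (η : X → ℝ) (p Δ : ℝ) : Set X :=
  {x | η x < 1 / 2 ∧ ∀ r : ℝ≥0, (r : ℝ≥0∞) ≤ probRadius μ x p →
    0 < μ (Metric.closedBall x r) → Δ ≤ 1 / 2 - ⨍ y in Metric.closedBall x r, η y ∂μ}

/-- The effective decision boundary `∂_{p, Δ}`. -/
def effBoundary (μ : Measure X) (η : X → ℝ) (p Δ : ℝ) : Set X :=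
  (effInteriorPos μ η p Δ ∪ effInteriorNeg μ η p Δ)ᶜ

end Space

section Sample

variable {X : Type*} [MetricSpace X] {n : ℕ}

/-- A sample of size `n`: the `i`-th entry is `((Xᵢ, Yᵢ), Zᵢ)` with instance `Xᵢ`, label `Yᵢ` and
tie-breaking draw `Zᵢ`. -/
abbrev Sample (X : Type*) (n : ℕ) : Type _ := Fin n → (X × Bool) × unitInterval

/-- The law of a sample: `n` i.i.d. draws from `P`, each with an independent uniform tie-breaking
draw from `[0,1]`. -/
def sampleLaw [MeasurableSpace X] (P : Measure (X × Bool)) (n : ℕ) : Measure (Sample X n) :=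
  Measure.pi fun _ => P.prod (volume : Measure unitInterval)

/-- `nnIndex S x i` is the index of the `(i+1)`-th nearest neighbour of `x` in the sample: sample
points are ordered by distance to `x`, ties going to the lower tie-breaking draw (and, in the null
event that these coincide too, to the lower index). -/
def nnIndex (S : Sample X n) (x : X) : Equiv.Perm (Fin n) :=
  Tuple.sort fun i => toLex (dist x (S i).1.1, (S i).2)

/-- The `k`-nearest neighbour vote `(1/k) ∑_{i=1}^k Y_{(i)}(x)` (for `k ≤ n`). -/
def knnVote (k : ℕ) (S : Sample X n) (x : X) : ℝ :=
  (1 / (k : ℝ)) * ∑ i : Fin n with i.val < k, if (S (nnIndex S x i)).1.2 = true then (1 : ℝ) else 0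

/-- The estimated hard region, with uniform convergence threshold `ΔUC`. -/
def hardRegion (k : ℕ) (ΔUC : ℝ) (S : Sample X n) : Set X :=
  {x | |knnVote k S x - 1 / 2| < 3 * ΔUC}

end Sample

section Constants

/-- `c_δ` -/
def cDelta (k : ℕ) (δ : ℝ) : ℝ := (1 - Real.sqrt (4 / (k : ℝ) * Real.log (2 / δ)))⁻¹

/-- `Δ` -/
def margin (k : ℕ) (δ : ℝ) : ℝ := min (1 / 2) (Real.sqrt (1 / (k : ℝ) * Real.log (2 / δ)))

/-- `Δ_UC` -/
def marginUC (c₀ : ℝ) (d k n : ℕ) (δ : ℝ) : ℝ :=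
  c₀ * Real.sqrt (((d : ℝ) * Real.log n + Real.log (1 / δ)) / (k : ℝ))

end Constants

end ActiveKNN

end

/-! Write `e = d log n + log (1/δ)` and `q = √(e/k)`; with `c₀ = 20` the hard region is `|vote -
1/2| < 60 q`. The proof bounds `|vote - η x|` and `|η x - 1/2|` separately.

The second term is deterministic. At a boundary point either `η x = 1/2`, or some ball of radius at
most `r(x;p)` has an `η`-average that misses the margin. The open ball of that radius has mass at
most `p`, so smoothness keeps `η` within `L p ^ α` of `η x` on the closed ball
(`abs_sub_half_le_of_mem_effBoundary`).

The first term (`abs_knnVote_sub_le`) splits into label noise and bias of `η`, each controlled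
uniformly in `x` by one event. Given instances and tie-breaks, the labels are independent Bernoulli
variables, and the neighbour sets, cut out by two balls and a tie threshold, are polynomially many
by Sauer–Shelah; Hoeffding and a union bound control the noise (`measure_labels_le`). By
symmetrization with a ghost sample, every ball of mass at least `k/n` contains nearly `k` sample
points (`measure_lowCount_le`). Hence nearly all `k` neighbours lie in a closed ball whose interior
version has mass at most `k/n`, where smoothness applies; each remaining one costs at most 1.

Full support makes the space separable, so countably many balls realize all traces on a finite
sample, which settles measurability. -/

noncomputable section

namespace ActiveKNN

/-! ### Sauer–Shelah bound for traces of balls. -/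

section Combinatorics

theorem sum_choose_le_add_one_pow (m d : ℕ) :
    ∑ j ∈ Finset.range (d + 1), m.choose j ≤ (m + 1) ^ d := by
  induction d with
  | zero => simp
  | succ d ih =>
    rw [Finset.sum_range_succ]
    calc _ ≤ (m + 1) ^ d + m ^ (d + 1) := add_le_add ih (Nat.choose_le_pow _ _)
      _ ≤ (m + 1) ^ d + (m + 1) ^ d * m := by
        rw [pow_succ m]; gcongr; omega
      _ = (m + 1) ^ (d + 1) := by ring

theorem card_le_of_shatters {β : Type*} {𝒞 : Set (Set β)} {d : ℕ} (hd : vcDim 𝒞 = d) {A : Finset β}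
    (hA : Shatters 𝒞 A) : A.card ≤ d := by
  have : (A.card : ℕ∞) ≤ vcDim 𝒞 := le_iSup₂_of_le A hA le_rfl
  rw [hd] at this
  exact_mod_cast this

variable {X : Type*} [MetricSpace X]

/-- On finitely many points, a strict distance bound can be replaced by a non-strict one. -/
theorem exists_radius_lt {ι : Type*} [Finite ι] (f : ι → ℝ) (r : ℝ) :
    ∃ s < r, ∀ i, f i < r ↔ f i ≤ s := by
  have := Fintype.ofFinite ι
  have h : ∀ i, ∀ᶠ s in nhdsWithin r (Set.Iio r), f i < r ↔ f i ≤ s := by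
    intro i
    by_cases hi : f i < r
    · filter_upwards [Ioo_mem_nhdsLT hi] with s hs
      exact ⟨fun _ => hs.1.le, fun _ => hi⟩
    · filter_upwards [self_mem_nhdsWithin] with s hs
      exact ⟨fun h => absurd h hi, fun h => h.trans_lt hs⟩
  obtain ⟨s, hs, hs'⟩ := ((Filter.eventually_all.2 h).and self_mem_nhdsWithin).exists
  exact ⟨s, hs', hs⟩

theorem exists_radius_gt {ι : Type*} [Finite ι] (f : ι → ℝ) (r : ℝ) :
    ∃ s, r < s ∧ ∀ i, f i ≤ r ↔ f i < s := by
  obtain ⟨s, hs, h⟩ := exists_radius_lt (fun i => -f i) (-r)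
  refine ⟨-s, by linarith, fun i => ?_⟩
  have := h i
  constructor
  · intro h1
    by_contra h2
    have := (h i).2 (by linarith)
    linarith
  · intro h1
    by_contra h2
    have := (h i).1 (by linarith)
    linarith

/-- The family of index sets that closed balls cut out of a finite family of points. -/
def ballTraces {ι : Type*} [Fintype ι] (p : ι → X) : Finset (Finset ι) :=
  open Classical in
  Finset.univ.filter fun T => ∃ (x : X) (r : ℝ), ∀ i, i ∈ T ↔ dist (p i) x ≤ r

theorem mem_ballTraces {ι : Type*} [Fintype ι] {p : ι → X} {T : Finset ι} :
    T ∈ ballTraces p ↔ ∃ (x : X) (r : ℝ), ∀ i, i ∈ T ↔ dist (p i) x ≤ r := by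
  simp [ballTraces]

theorem exists_augBall_eq {ι : Type*} [Fintype ι] (p : ι → X) (x : X) (r : ℝ) :
    ∃ C ∈ augBalls X, ∀ i, (p i, (0 : unitInterval)) ∈ C ↔ dist (p i) x ≤ r := by
  rcases lt_or_ge r 0 with hr | hr
  -- A negative radius cuts out nothing, but the family only has radii `≥ 0`; the augmented ball
  -- with `r' = z' = 0` is empty.
  · refine ⟨augBall x 0 0, ⟨x, 0, 0, le_rfl, rfl⟩, fun i => ?_⟩
    have h0 := dist_nonneg (x := p i) (y := x)
    simp only [augBall, Set.mem_ofPred_eq, lt_self_iff_false, and_false, or_false]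
    constructor <;> intro h <;> linarith
  · obtain ⟨s, hs, h⟩ := exists_radius_gt (fun i => dist (p i) x) r
    refine ⟨augBall x s 0, ⟨x, s, 0, by linarith, rfl⟩, fun i => ?_⟩
    simp only [augBall, Set.mem_ofPred_eq, lt_self_iff_false, and_false, or_false]
    exact (h i).symm

/-- At height `z = 0` the tie clause is void, so augmented balls restrict to open balls, which on
finitely many points cut out the same sets as closed balls. Shattering by traces thus lifts to
shattering by augmented balls, and Sauer–Shelah applies. -/
theorem card_ballTraces_le {d : ℕ} (hd : vcDim (augBalls X) = d) {ι : Type*} [Fintype ι]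
    (p : ι → X) : (ballTraces p).card ≤ (Fintype.card ι + 1) ^ d := by
  classical
  have hvc : (ballTraces p).vcDim ≤ d := by
    refine Finset.sup_le fun I hI => ?_
    rw [Finset.mem_shatterer] at hI
    -- The points may repeat, but a trace cannot separate two indices of the same point, so a
    -- shattered index set carries distinct points.
    have hinj : Set.InjOn (fun i => (p i, (0 : unitInterval))) I := by
      intro i hi j hj hij
      obtain ⟨u, hu, hu'⟩ := hI (t := {i}) (by simpa using hi)
      obtain ⟨x, r, hx⟩ := mem_ballTraces.1 hu
      have hiu : i ∈ u := by
        have : i ∈ I ∩ u := by rw [hu']; simp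
        exact (Finset.mem_inter.1 this).2
      have hju : j ∈ u := by
        have hp : p i = p j := congrArg Prod.fst hij
        rw [hx, ← hp, ← hx]; exact hiu
      have : j ∈ I ∩ u := Finset.mem_inter.2 ⟨hj, hju⟩
      rw [hu'] at this
      exact (Finset.mem_singleton.1 this).symm
    rw [← Finset.card_image_of_injOn hinj]
    refine card_le_of_shatters hd fun T hT => ?_
    obtain ⟨u, hu, hu'⟩ := hI (t := I.filter fun i => (p i, (0 : unitInterval)) ∈ T)
      (Finset.filter_subset _ _)
    obtain ⟨x, r, hx⟩ := mem_ballTraces.1 hu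
    obtain ⟨C, hC, hCx⟩ := exists_augBall_eq p x r
    refine ⟨C, hC, ?_⟩
    have key : ∀ i ∈ I, ((p i, (0 : unitInterval)) ∈ C ↔ (p i, (0 : unitInterval)) ∈ T) := by
      intro i hi
      rw [hCx, ← hx]
      have := congrArg (i ∈ ·) hu'
      simpa [hi] using this
    ext q
    constructor
    · rintro ⟨hq, hqC⟩
      obtain ⟨i, hi, rfl⟩ := Finset.mem_image.1 (Finset.mem_coe.1 hq)
      exact (key i hi).1 hqC
    · intro hq
      refine ⟨hT hq, ?_⟩
      obtain ⟨i, hi, rfl⟩ := Finset.mem_image.1 (Finset.mem_coe.1 (hT hq))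
      exact (key i hi).2 hq
  calc (ballTraces p).card ≤ ∑ j ∈ Finset.Iic (ballTraces p).vcDim, (Fintype.card ι).choose j :=
        (Finset.card_le_card_shatterer _).trans Finset.card_shatterer_le_sum_vcDim
    _ ≤ ∑ j ∈ Finset.range (d + 1), (Fintype.card ι).choose j := by
        refine Finset.sum_le_sum_of_subset fun j hj => ?_
        rw [Finset.mem_Iic] at hj
        rw [Finset.mem_range]
        omega
    _ ≤ _ := sum_choose_le_add_one_pow _ _

/-- Singletons are shattered. This lets `d log n` and `d` absorb the `log 2` in `log (2/δ)`. -/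
theorem one_le_of_vcDim_eq [Nonempty X] {d : ℕ} (hd : vcDim (augBalls X) = d) : 1 ≤ d := by
  obtain ⟨x⟩ := ‹Nonempty X›
  have : Shatters (augBalls X) {(x, (0 : unitInterval))} := by
    intro T hT
    by_cases h : (x, (0 : unitInterval)) ∈ T
    · refine ⟨augBall x 1 0, ⟨x, 1, 0, zero_le_one, rfl⟩, ?_⟩
      ext q
      constructor
      · rintro ⟨hq, -⟩
        rw [Finset.coe_singleton, Set.mem_singleton_iff] at hq
        rwa [hq]
      · intro hq
        refine ⟨hT hq, ?_⟩
        have := hT hq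
        rw [Finset.coe_singleton, Set.mem_singleton_iff] at this
        rw [this]
        simp [augBall]
    · refine ⟨augBall x 0 0, ⟨x, 0, 0, le_rfl, rfl⟩, ?_⟩
      ext q
      constructor
      · rintro ⟨hq, hq'⟩
        rw [Finset.coe_singleton, Set.mem_singleton_iff] at hq
        rw [hq] at hq'
        simp [augBall] at hq'
      · intro hq
        have := hT hq
        rw [Finset.coe_singleton, Set.mem_singleton_iff] at this
        exact absurd (this ▸ hq) h
  simpa using card_le_of_shatters hd this

end Combinatorics

/-! ### Separability and reduction to countably many balls. -/

section Countable

variable {X : Type*} [MetricSpace X]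

/-- A finite measure of full support lives on a separable metric space. -/
theorem secondCountable_of_isOpenPosMeasure [MeasurableSpace X] [BorelSpace X] (μ : Measure X)
    [IsFiniteMeasure μ] [μ.IsOpenPosMeasure] : SecondCountableTopology X := by
  refine Metric.secondCountable_of_almost_dense_set fun ε hε => ?_
  -- A maximal `ε`-separated set is an `ε`-net, and it is countable because the disjoint `ε/2`-balls
  -- around it all have positive mass.
  obtain ⟨s, hs⟩ := zorn_subset {s : Set X | s.Pairwise fun x y => ε < dist x y} (by
    intro c hc hchain
    refine ⟨⋃₀ c, ?_, fun s hs => Set.subset_sUnion_of_mem hs⟩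
    exact (Set.pairwise_sUnion hchain.directedOn).2 hc)
  refine ⟨s, ?_, fun x => ?_⟩
  · have h := Measure.countable_meas_pos_of_disjoint_iUnion (μ := μ)
      (As := fun x : s => Metric.ball (x : X) (ε / 2)) (fun _ => Metric.isOpen_ball.measurableSet)
      (by
        intro x y hxy
        refine Metric.ball_disjoint_ball ?_
        have := hs.prop x.2 y.2 (fun h => hxy (Subtype.ext h))
        linarith)
    have huniv : {x : s | 0 < μ (Metric.ball (x : X) (ε / 2))} = Set.univ :=
      Set.eq_univ_of_forall fun x => Metric.measure_ball_pos μ _ (by positivity)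
    rw [huniv] at h
    exact Set.countable_coe_iff.1 (Set.countable_univ_iff.1 h)
  · by_contra! hx
    have hxs : x ∉ s := fun h => by simpa using hε.trans (hx x h)
    have hins : (insert x s).Pairwise fun x y => ε < dist x y :=
      hs.prop.insert fun y hy _ => ⟨hx y hy, by rw [dist_comm]; exact hx y hy⟩
    exact hxs (hs.le_of_ge hins (Set.subset_insert _ _) (Set.mem_insert _ _))

variable [Nonempty X] [TopologicalSpace.SeparableSpace X]

variable (X) in
/-- A countable family of closed balls: centres in a dense sequence, rational radii. -/
def ratBall (b : ℕ × ℚ) : Set X :=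
  Metric.closedBall (TopologicalSpace.denseSeq X b.1) b.2

/-- No sample point has distance strictly between `r` and `s`, so there is room to perturb the
centre by a quarter of that gap and round the radius up. The inclusion is kept because lower bounds
on mass must survive the replacement. -/
theorem exists_ratBall_closed {ι : Type*} [Finite ι] (p : ι → X) (x : X) (r : ℝ) :
    ∃ b, Metric.closedBall x r ⊆ ratBall X b ∧ ∀ i, p i ∈ ratBall X b ↔ dist (p i) x ≤ r := by
  obtain ⟨s, hs, h⟩ := exists_radius_gt (fun i => dist (p i) x) r
  obtain ⟨m, hm⟩ := (TopologicalSpace.denseRange_denseSeq X).exists_dist_lt x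
    (show 0 < (s - r) / 4 by linarith)
  obtain ⟨q, hq, hq'⟩ := exists_rat_btwn (show r + (s - r) / 4 < r + (s - r) / 2 by linarith)
  have hsub : Metric.closedBall x r ⊆ ratBall X (m, q) :=
    Metric.closedBall_subset_closedBall' (by linarith)
  refine ⟨(m, q), hsub, fun i => ⟨fun hi => ?_, fun hi => hsub hi⟩⟩
  rw [h]
  have h1 : dist (p i) (TopologicalSpace.denseSeq X m) ≤ q := hi
  have h2 := dist_triangle_right (p i) x (TopologicalSpace.denseSeq X m)
  linarith

theorem exists_ratBall_open {ι : Type*} [Finite ι] (p : ι → X) (x : X) (r : ℝ) :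
    ∃ b, ∀ i, p i ∈ ratBall X b ↔ dist (p i) x < r := by
  obtain ⟨s, -, h⟩ := exists_radius_lt (fun i => dist (p i) x) r
  obtain ⟨b, -, hb⟩ := exists_ratBall_closed p x s
  exact ⟨b, fun i => (hb i).trans (h i).symm⟩

theorem measurableSet_ratBall [MeasurableSpace X] [BorelSpace X] (b : ℕ × ℚ) :
    MeasurableSet (ratBall X b) := Metric.isClosed_closedBall.measurableSet

theorem filter_ratBall_mem_ballTraces {ι : Type*} [Fintype ι] (p : ι → X) (b : ℕ × ℚ)
    [DecidablePred fun i => p i ∈ ratBall X b] :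
    (Finset.univ.filter fun i => p i ∈ ratBall X b) ∈ ballTraces p :=
  mem_ballTraces.2 ⟨TopologicalSpace.denseSeq X b.1, b.2, fun i => by simp [ratBall]⟩

end Countable

/-! ### Hoeffding with random weights and a union bound. -/

section Concentration

open ProbabilityTheory

variable {n : ℕ}

/-- The law of `n` independent uniform draws from `[0,1]`. -/
abbrev uniformLaw (n : ℕ) : Measure (Fin n → unitInterval) :=
  Measure.pi fun _ => (volume : Measure unitInterval)

/-- Weighted sum of the centred Bernoulli variables `1[uᵢ < pᵢ] - pᵢ`. -/
def bernDev (a p : Fin n → ℝ) (u : Fin n → unitInterval) : ℝ :=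
  ∑ i, a i * ((if (u i : ℝ) < p i then 1 else 0) - p i)

theorem measure_coe_lt {t : ℝ} (ht : t ∈ Set.Icc (0 : ℝ) 1) :
    (volume : Measure unitInterval) {u | (u : ℝ) < t} = ENNReal.ofReal t :=
  unitInterval.volume_Iio ⟨t, ht⟩

theorem measurable_bernoulli (t : ℝ) :
    Measurable fun u : unitInterval => if (u : ℝ) < t then (1 : ℝ) else 0 :=
  Measurable.ite (measurableSet_lt measurable_subtype_coe measurable_const) measurable_const
    measurable_const

theorem hasSubgaussianMGF_bernoulli {t : ℝ} (ht : t ∈ Set.Icc (0 : ℝ) 1) :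
    HasSubgaussianMGF (fun u : unitInterval => (if (u : ℝ) < t then (1 : ℝ) else 0) - t)
      (1 / 4) volume := by
  have h := hasSubgaussianMGF_of_mem_Icc (a := 0) (b := 1)
    (measurable_bernoulli t).aemeasurable (μ := (volume : Measure unitInterval))
    (Filter.Eventually.of_forall fun u => by
      show (if (u : ℝ) < t then (1 : ℝ) else 0) ∈ Set.Icc 0 1
      split_ifs <;> simp)
  have hint : ∫ u : unitInterval, (if (u : ℝ) < t then (1 : ℝ) else 0) = t := by
    have hm : MeasurableSet {u : unitInterval | (u : ℝ) < t} :=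
      measurableSet_lt measurable_subtype_coe measurable_const
    have : (fun u : unitInterval => if (u : ℝ) < t then (1 : ℝ) else 0)
        = Set.indicator {u : unitInterval | (u : ℝ) < t} 1 := by
      ext u; simp [Set.indicator_apply]
    rw [this, integral_indicator_one hm, measureReal_def, measure_coe_lt ht,
      ENNReal.toReal_ofReal ht.1]
  rw [hint] at h
  convert h using 1
  ext
  norm_num

/-- Hoeffding's inequality, normalized by the sum of squared weights. -/
theorem measure_bernDev_le (a p : Fin n → ℝ) (hp : ∀ i, p i ∈ Set.Icc (0 : ℝ) 1) (s : ℝ) :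
    uniformLaw n {u | 0 < bernDev a p u ∧ s * ∑ i, a i ^ 2 ≤ bernDev a p u ^ 2}
      ≤ ENNReal.ofReal (Real.exp (-2 * s)) := by
  have hVn : 0 ≤ ∑ i, a i ^ 2 := Finset.sum_nonneg fun i _ => sq_nonneg _
  rcases le_or_gt s 0 with hs | hs
  · refine prob_le_one.trans ?_
    rw [← ENNReal.ofReal_one]
    exact ENNReal.ofReal_le_ofReal (Real.one_le_exp (by linarith))
  rcases hVn.eq_or_lt with hV | hV
  -- With zero weights the quadratic inequality holds trivially; the strict positivity clause is
  -- what empties the event.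
  · have ha : ∀ i, a i = 0 := fun i => by
      have := (Finset.sum_eq_zero_iff_of_nonneg (fun i _ => sq_nonneg (a i))).1 hV.symm i
        (Finset.mem_univ i)
      exact pow_eq_zero_iff two_ne_zero |>.1 this
    have : {u | 0 < bernDev a p u ∧ s * ∑ i, a i ^ 2 ≤ bernDev a p u ^ 2} = ∅ := by
      ext u
      simp [bernDev, ha]
    rw [this, measure_empty]
    exact zero_le
  set V := ∑ i, a i ^ 2 with hVdef
  have hsub : ∀ i ∈ Finset.univ, HasSubgaussianMGF
      (fun u : Fin n → unitInterval => a i * ((if (u i : ℝ) < p i then 1 else 0) - p i))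
      (⟨a i ^ 2, sq_nonneg _⟩ * (1 / 4)) (uniformLaw n) := by
    intro i _
    have h := (hasSubgaussianMGF_bernoulli (hp i)).const_mul (a i)
    rw [← (measurePreserving_eval (fun _ : Fin n => (volume : Measure unitInterval)) i).map_eq] at h
    exact HasSubgaussianMGF.of_map (Y := fun u : Fin n → unitInterval => u i)
      (measurable_pi_apply i).aemeasurable h
  have hind : iIndepFun (fun i (u : Fin n → unitInterval) =>
      a i * ((if (u i : ℝ) < p i then 1 else 0) - p i)) (uniformLaw n) :=
    iIndepFun_pi (X := fun i (v : unitInterval) => a i * ((if (v : ℝ) < p i then 1 else 0) - p i))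
      fun i => (((measurable_bernoulli (p i)).sub_const _).const_mul _).aemeasurable
  -- The threshold `√(s V)` against the variance proxy `V / 4` gives the exponent `-2 s`, free of
  -- the weights; this is what permits weights depending on `ω` in the union bound.
  have h := HasSubgaussianMGF.measure_sum_ge_le_of_iIndepFun hind hsub
    (Real.sqrt_nonneg (s * V))
  have hsum : ((∑ i, (⟨a i ^ 2, sq_nonneg _⟩ * (1 / 4) : ℝ≥0) : ℝ≥0) : ℝ) = V / 4 := by
    rw [NNReal.coe_sum, hVdef, Finset.sum_div]
    refine Finset.sum_congr rfl fun i _ => ?_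
    change a i ^ 2 * (1 / 4) = _
    ring
  rw [hsum, Real.sq_sqrt (by positivity)] at h
  have hexp : -(s * V) / (2 * (V / 4)) = -2 * s := by
    field_simp
    ring
  rw [hexp] at h
  refine le_trans (measure_mono ?_) ((ENNReal.le_ofReal_iff_toReal_le (measure_ne_top _ _)
    (Real.exp_nonneg _)).2 h)
  rintro u ⟨hu, hu'⟩
  exact (Real.sqrt_le_left hu.le).2 hu'

theorem measurable_bernDev {Ω : Type*} [MeasurableSpace Ω] {a p : Ω → Fin n → ℝ}
    (ha : Measurable a) (hp : Measurable p) :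
    Measurable fun x : Ω × (Fin n → unitInterval) => bernDev (a x.1) (p x.1) x.2 := by
  unfold bernDev
  refine Finset.measurable_sum _ fun i _ => ?_
  have hpi : Measurable fun x : Ω × (Fin n → unitInterval) => p x.1 i :=
    (measurable_pi_apply i).comp (hp.comp measurable_fst)
  have hai : Measurable fun x : Ω × (Fin n → unitInterval) => a x.1 i :=
    (measurable_pi_apply i).comp (ha.comp measurable_fst)
  have hui : Measurable fun x : Ω × (Fin n → unitInterval) => (x.2 i : ℝ) :=
    measurable_subtype_coe.comp ((measurable_pi_apply i).comp measurable_snd)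
  exact hai.mul ((Measurable.ite (measurableSet_lt hui hpi) measurable_const
    measurable_const).sub hpi)

/-- Union bound over a countable family of weight vectors that, for each fixed `ω`, takes at most
`N` values. -/
theorem measure_exists_bernDev_le {Ω ι : Type*} [MeasurableSpace Ω] [Countable ι] (ν : Measure Ω)
    [IsProbabilityMeasure ν] {a : ι → Ω → Fin n → ℝ} {p : Ω → Fin n → ℝ}
    (ha : ∀ j, Measurable (a j)) (hp : Measurable p) (hp' : ∀ ω i, p ω i ∈ Set.Icc (0 : ℝ) 1)
    {N : ℕ} (hN : ∀ ω, ∃ F : Finset (Fin n → ℝ), F.card ≤ N ∧ ∀ j, a j ω ∈ F) (s : ℝ) :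
    (ν.prod (uniformLaw n)) {x | ∃ j, 0 < bernDev (a j x.1) (p x.1) x.2 ∧
        s * ∑ i, a j x.1 i ^ 2 ≤ bernDev (a j x.1) (p x.1) x.2 ^ 2}
      ≤ ENNReal.ofReal (N * Real.exp (-2 * s)) := by
  have hmeas : MeasurableSet {x : Ω × (Fin n → unitInterval) |
      ∃ j, 0 < bernDev (a j x.1) (p x.1) x.2 ∧
        s * ∑ i, a j x.1 i ^ 2 ≤ bernDev (a j x.1) (p x.1) x.2 ^ 2} := by
    rw [Set.ofPred_exists]
    refine MeasurableSet.iUnion fun j => ?_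
    have hW := measurable_bernDev (ha j) hp
    refine (measurableSet_lt measurable_const hW).inter (measurableSet_le ?_ (hW.pow_const 2))
    exact (Finset.measurable_sum _ fun i _ => ((measurable_pi_apply i).comp
      ((ha j).comp measurable_fst)).pow_const 2).const_mul s
  rw [Measure.prod_apply hmeas]
  -- Fubini: for fixed `ω` the countable union collapses to at most `N` weight vectors.
  refine (lintegral_mono (g := fun _ => ENNReal.ofReal (N * Real.exp (-2 * s))) fun ω => ?_).trans
    (by simp)
  obtain ⟨F, hF, haF⟩ := hN ω
  have hsub : Prod.mk ω ⁻¹' {x : Ω × (Fin n → unitInterval) |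
      ∃ j, 0 < bernDev (a j x.1) (p x.1) x.2 ∧
        s * ∑ i, a j x.1 i ^ 2 ≤ bernDev (a j x.1) (p x.1) x.2 ^ 2}
      ⊆ ⋃ b ∈ F, {u | 0 < bernDev b (p ω) u ∧ s * ∑ i, b i ^ 2 ≤ bernDev b (p ω) u ^ 2} := by
    rintro u ⟨j, hj⟩
    exact Set.mem_biUnion (haF j) hj
  calc _ ≤ ∑ b ∈ F, uniformLaw n
        {u | 0 < bernDev b (p ω) u ∧ s * ∑ i, b i ^ 2 ≤ bernDev b (p ω) u ^ 2} :=
        (measure_mono hsub).trans (measure_biUnion_finset_le _ _)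
    _ ≤ ∑ _b ∈ F, ENNReal.ofReal (Real.exp (-2 * s)) :=
        Finset.sum_le_sum fun b _ => measure_bernDev_le b (p ω) (hp' ω) s
    _ = F.card * ENNReal.ofReal (Real.exp (-2 * s)) := by simp
    _ ≤ N * ENNReal.ofReal (Real.exp (-2 * s)) := by gcongr
    _ = _ := by
      rw [ENNReal.ofReal_mul (by positivity), ENNReal.ofReal_natCast]

end Concentration

/-! ### Neighbour sets as traces of two balls and a tie threshold. -/

section Neighbours

variable {X : Type*} [MetricSpace X] {n : ℕ}

/-- Order of the tie-breaking draws, the lower index coming first among equal draws. -/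
def tieLT (z : Fin n → unitInterval) (i j : Fin n) : Prop := z i < z j ∨ z i = z j ∧ i < j

open Classical in
/-- The indices of the sample points that precede the `j`-th one in the order of nearest
neighbours of `x`. -/
def nearer (S : Sample X n) (x : X) (j : Fin n) : Finset (Fin n) :=
  Finset.univ.filter fun i => dist (S i).1.1 x < dist (S j).1.1 x ∨
    dist (S i).1.1 x ≤ dist (S j).1.1 x ∧ tieLT (fun i => (S i).2) i j

/-- Using `≤` instead of `=` in the second alternative changes nothing, given the first, and
exhibits the set as an open-ball trace together with part of a closed-ball trace. -/
theorem mem_nearer {S : Sample X n} {x : X} {i j : Fin n} :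
    i ∈ nearer S x j ↔ dist (S i).1.1 x < dist (S j).1.1 x ∨
      dist (S i).1.1 x ≤ dist (S j).1.1 x ∧ tieLT (fun i => (S i).2) i j := by
  classical
  simp [nearer]

/-- `Tuple.sort` resolves equal keys by index, exactly as `tieLT` does; the converse direction is
asymmetry of the resulting order. -/
theorem mem_nearer_nnIndex (S : Sample X n) (x : X) (i j : Fin n) :
    nnIndex S x i ∈ nearer S x (nnIndex S x j) ↔ i < j := by
  set f : Fin n → ℝ ×ₗ unitInterval := fun i => toLex (dist x (S i).1.1, (S i).2) with hf
  obtain ⟨hmono, htie⟩ := Tuple.eq_sort_iff.1 (show nnIndex S x = Tuple.sort f from rfl)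
  have hlt : ∀ a b, a ∈ nearer S x b ↔ f a < f b ∨ f a = f b ∧ a < b := by
    intro a b
    simp only [mem_nearer, tieLT, hf,
      Prod.Lex.toLex_lt_toLex, dist_comm x, EmbeddingLike.apply_eq_iff_eq, Prod.mk.injEq]
    constructor
    · rintro (h | ⟨h, h' | h'⟩)
      · exact Or.inl (Or.inl h)
      · rcases h.lt_or_eq with h1 | h1
        · exact Or.inl (Or.inl h1)
        · exact Or.inl (Or.inr ⟨h1, h'⟩)
      · rcases h.lt_or_eq with h1 | h1
        · exact Or.inl (Or.inl h1)
        · exact Or.inr ⟨⟨h1, h'.1⟩, h'.2⟩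
    · rintro ((h | h) | h)
      · exact Or.inl h
      · exact Or.inr ⟨h.1.le, Or.inl h.2⟩
      · exact Or.inr ⟨h.1.1.le, Or.inr ⟨h.1.2, h.2⟩⟩
  have himp : ∀ a b, a < b → nnIndex S x a ∈ nearer S x (nnIndex S x b) := by
    intro a b hab
    rw [hlt]
    rcases (hmono hab.le).lt_or_eq with h | h
    · exact Or.inl h
    · exact Or.inr ⟨h, htie a b hab h⟩
  refine ⟨fun h => ?_, himp i j⟩
  by_contra hij
  rw [hlt] at h
  rcases (not_lt.1 hij).lt_or_eq with hji | hji
  · have h2 := himp j i hji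
    rw [hlt] at h2
    rcases h with h | h <;> rcases h2 with h2 | h2
    · exact lt_asymm h h2
    · exact h.ne h2.1.symm
    · exact h2.ne h.1.symm
    · exact lt_asymm h.2 h2.2
  · subst hji
    rcases h with h | h
    · exact lt_irrefl _ h
    · exact lt_irrefl _ h.2

/-- The `k` nearest neighbours of `x` are the points preceding the `(k+1)`-th neighbour. -/
theorem exists_knnVote_eq {k : ℕ} (hk : k < n) (S : Sample X n) (x : X) :
    ∃ j, (nearer S x j).card = k ∧ knnVote k S x
      = (1 / (k : ℝ)) * ∑ i ∈ nearer S x j, if (S i).1.2 = true then (1 : ℝ) else 0 := by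
  refine ⟨nnIndex S x ⟨k, hk⟩, ?_⟩
  have himage : nearer S x (nnIndex S x ⟨k, hk⟩)
      = (Finset.univ.filter fun i : Fin n => i.val < k).map (nnIndex S x).toEmbedding := by
    ext i
    obtain ⟨i, rfl⟩ := (nnIndex S x).surjective i
    rw [mem_nearer_nnIndex]
    simp [Fin.lt_def]
  rw [himage]
  refine ⟨?_, ?_⟩
  · rw [Finset.card_map, Fin.card_filter_val_lt]
    omega
  · rw [Finset.sum_map]
    rfl

/-- Index data for the candidate neighbour sets: two balls, a threshold index and a sign. -/
abbrev WeightIndex (n : ℕ) : Type := (ℕ × ℚ) × (ℕ × ℚ) × Fin n × Bool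

variable [Nonempty X] [TopologicalSpace.SeparableSpace X]

open Classical in
/-- Signed indicator of the sample points lying in the first ball, or in the second one and before
the threshold index in the tie-breaking order. -/
def nnWeight (b : WeightIndex n) (w : Fin n → X × unitInterval) (i : Fin n) : ℝ :=
  (if b.2.2.2 then 1 else -1) * if (w i).1 ∈ ratBall X b.1 ∨
    (w i).1 ∈ ratBall X b.2.1 ∧ tieLT (fun i => (w i).2) i b.2.2.1 then 1 else 0

theorem exists_nnWeight_eq (S : Sample X n) (x : X) (j : Fin n) (sgn : Bool) :
    ∃ b, nnWeight b (fun i => ((S i).1.1, (S i).2))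
      = fun i => (if sgn then 1 else -1) * if i ∈ nearer S x j then 1 else 0 := by
  obtain ⟨b₁, h₁⟩ := exists_ratBall_open (fun i => (S i).1.1) x (dist (S j).1.1 x)
  obtain ⟨b₂, -, h₂⟩ := exists_ratBall_closed (fun i => (S i).1.1) x (dist (S j).1.1 x)
  refine ⟨(b₁, b₂, j, sgn), funext fun i => ?_⟩
  classical
  rw [nnWeight]
  congr 1
  exact if_congr (by rw [mem_nearer, h₁, h₂]) rfl rfl

/-- A weight vector depends only on the two ball traces, the threshold index and the sign, whence
the product of the four counts. -/
theorem exists_finset_nnWeight {d : ℕ} (hd : vcDim (augBalls X) = d)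
    (w : Fin n → X × unitInterval) :
    ∃ F : Finset (Fin n → ℝ), F.card ≤ (n + 1) ^ d * ((n + 1) ^ d * (n * 2)) ∧
      ∀ b, nnWeight b w ∈ F := by
  classical
  let g : Finset (Fin n) × Finset (Fin n) × Fin n × Bool → Fin n → ℝ := fun t i =>
    (if t.2.2.2 then 1 else -1) * if i ∈ t.1 ∨
      i ∈ t.2.1 ∧ tieLT (fun i => (w i).2) i t.2.2.1 then 1 else 0
  let B := ballTraces fun i => (w i).1
  refine ⟨(B ×ˢ B ×ˢ Finset.univ ×ˢ Finset.univ).image g, ?_, fun b => ?_⟩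
  · refine Finset.card_image_le.trans ?_
    have hB : B.card ≤ (n + 1) ^ d := by
      simpa using card_ballTraces_le hd fun i => (w i).1
    simp only [Finset.card_product, Finset.card_univ, Fintype.card_fin, Fintype.card_bool]
    gcongr
  · refine Finset.mem_image.2 ⟨(Finset.univ.filter fun i => (w i).1 ∈ ratBall X b.1,
      Finset.univ.filter fun i => (w i).1 ∈ ratBall X b.2.1, b.2.2), ?_, ?_⟩
    · simp only [Finset.mem_product, Finset.mem_univ, and_true]
      exact ⟨filter_ratBall_mem_ballTraces _ _, filter_ratBall_mem_ballTraces _ _⟩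
    · ext i
      simp only [g, nnWeight, Finset.mem_filter, Finset.mem_univ, true_and]

variable [MeasurableSpace X] [BorelSpace X]

theorem measurable_nnWeight (b : WeightIndex n) : Measurable (nnWeight (X := X) b) := by
  refine measurable_pi_iff.2 fun i => ?_
  refine Measurable.const_mul (Measurable.ite ?_ measurable_const measurable_const) _
  have hx : ∀ c, MeasurableSet {w : Fin n → X × unitInterval | (w i).1 ∈ ratBall X c} := fun c =>
    (measurable_fst.comp (measurable_pi_apply i)) (measurableSet_ratBall c)
  have hz : ∀ i, Measurable fun w : Fin n → X × unitInterval => (w i).2 := fun i =>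
    measurable_snd.comp (measurable_pi_apply i)
  refine (hx _).union ((hx _).inter ((measurableSet_lt (hz _) (hz _)).union
    ((measurableSet_eq_fun (hz _) (hz _)).inter (MeasurableSet.const _))))

end Neighbours

/-! ### Conditional independence of labels and their concentration. -/

section Labels

variable {X : Type*} [MeasurableSpace X] {n : ℕ}

/-- Labels generated by thresholding uniform draws at `η`. -/
theorem measurePreserving_label {P : Measure (X × Bool)} [IsProbabilityMeasure P] {η : X → ℝ}
    (hη : IsCondProb P η) :
    MeasurePreserving (fun q : X × unitInterval => (q.1, decide ((q.2 : ℝ) < η q.1)))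
      (P.fst.prod volume) P := by
  have hlt : MeasurableSet {q : X × unitInterval | (q.2 : ℝ) < η q.1} :=
    measurableSet_lt (measurable_subtype_coe.comp measurable_snd)
      (hη.measurable.comp measurable_fst)
  have hdec : Measurable fun q : X × unitInterval => decide ((q.2 : ℝ) < η q.1) := by
    refine measurable_to_bool ?_
    convert hlt using 1
    ext q
    simp
  have hf : Measurable fun q : X × unitInterval => (q.1, decide ((q.2 : ℝ) < η q.1)) :=
    measurable_fst.prodMk hdec
  have htrue : ∀ A : Set X, MeasurableSet A →
      (P.fst.prod volume) {q : X × unitInterval | q.1 ∈ A ∧ (q.2 : ℝ) < η q.1}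
        = P (A ×ˢ {true}) := by
    intro A hA
    have hm : MeasurableSet {q : X × unitInterval | q.1 ∈ A ∧ (q.2 : ℝ) < η q.1} :=
      (measurable_fst hA).inter hlt
    rw [Measure.prod_apply hm, hη.lintegral_eq A hA, ← lintegral_indicator hA]
    refine lintegral_congr fun x => ?_
    by_cases hx : x ∈ A
    · simpa [hx] using measure_coe_lt (hη.mem_Icc x)
    · simp [hx]
  have huniv : ∀ A : Set X, MeasurableSet A →
      (P.fst.prod volume) {q : X × unitInterval | q.1 ∈ A} = P (A ×ˢ Set.univ) := by
    intro A hA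
    have : {q : X × unitInterval | q.1 ∈ A} = A ×ˢ Set.univ := by ext; simp
    rw [this, Measure.prod_prod, Measure.fst_apply hA, measure_univ, mul_one]
    congr 1
    ext; simp
  refine ⟨hf, Measure.ext_prod fun {A t} hA ht => ?_⟩
  rw [Measure.map_apply hf (hA.prod ht)]
  by_cases h1 : true ∈ t <;> by_cases h0 : false ∈ t
  · have : t = Set.univ := by ext b; cases b <;> simp [h0, h1]
    rw [this, ← huniv A hA]
    congr 1
    ext
    simp only [Set.mem_preimage, Set.mem_prod, Set.mem_univ, and_true, Set.mem_ofPred_eq]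
  · have : t = {true} := by ext b; cases b <;> simp [h0, h1]
    rw [this, ← htrue A hA]
    congr 1
    ext; simp
  · have : t = {false} := by ext b; cases b <;> simp [h0, h1]
    -- `IsCondProb` only describes label `true`; label `false` follows by subtraction from the whole
    -- cylinder.
    have hP : P (A ×ˢ Set.univ) = P (A ×ˢ {false}) + P (A ×ˢ {true}) := by
      rw [← measure_union ?_ (hA.prod (MeasurableSet.singleton _)), ← Set.prod_union]
      · congr 2
        ext b; cases b <;> simp
      · rw [Set.disjoint_left]
        rintro ⟨x, b⟩ ⟨-, hb⟩ ⟨-, hb'⟩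
        simp_all
    have hQ : (P.fst.prod volume) {q : X × unitInterval | q.1 ∈ A}
        = (P.fst.prod volume) ((fun q : X × unitInterval =>
            (q.1, decide ((q.2 : ℝ) < η q.1))) ⁻¹' A ×ˢ {false})
          + (P.fst.prod volume) {q : X × unitInterval | q.1 ∈ A ∧ (q.2 : ℝ) < η q.1} := by
      rw [← measure_union ?_ (show MeasurableSet {q : X × unitInterval | q.1 ∈ A ∧ (q.2 : ℝ) < η q.1}
        from (measurable_fst hA).inter hlt)]
      · congr 1
        ext q
        simp only [Set.mem_ofPred_eq, Set.mem_union, Set.mem_preimage, Set.mem_prod,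
          Set.mem_singleton_iff, decide_eq_false_iff_not]
        tauto
      · rw [Set.disjoint_left]
        rintro q ⟨-, hb⟩ ⟨-, hb'⟩
        simp_all
    rw [this]
    rw [huniv A hA, htrue A hA, hP] at hQ
    exact ((ENNReal.add_left_inj (measure_ne_top _ _)).1 hQ).symm
  · have : t = ∅ := by ext b; cases b <;> simp [h0, h1]
    rw [this]
    simp

theorem measurePreserving_sample {P : Measure (X × Bool)} [IsProbabilityMeasure P] {η : X → ℝ}
    (hη : IsCondProb P η) :
    MeasurePreserving (fun (q : (Fin n → X × unitInterval) × (Fin n → unitInterval)) i =>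
        (((q.1 i).1, decide ((q.2 i : ℝ) < η (q.1 i).1)), (q.1 i).2))
      ((Measure.pi fun _ => P.fst.prod volume).prod (uniformLaw n)) (sampleLaw P n) := by
  have hφ : MeasurePreserving (fun q : (X × unitInterval) × unitInterval =>
      ((q.1.1, decide ((q.2 : ℝ) < η q.1.1)), q.1.2))
      ((P.fst.prod volume).prod volume) (P.prod volume) := by
    -- The tie-break is swapped with the label-generating uniform, so that the latter sits next to
    -- the instance.
    have h1 := measurePreserving_prodAssoc P.fst (volume : Measure unitInterval)
      (volume : Measure unitInterval)
    have h2 := (MeasurePreserving.id P.fst).prod (Measure.measurePreserving_swap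
      (μ := (volume : Measure unitInterval)) (ν := (volume : Measure unitInterval)))
    have h4 := (measurePreserving_label hη).prod
      (MeasurePreserving.id (volume : Measure unitInterval))
    exact h4.comp ((h1.symm _).comp (h2.comp h1))
  have hpi := measurePreserving_pi (fun _ : Fin n => (P.fst.prod volume).prod volume)
    (fun _ : Fin n => P.prod (volume : Measure unitInterval)) (fun _ => hφ)
  exact hpi.comp ((measurePreserving_arrowProdEquivProdArrow (X × unitInterval) unitInterval (Fin n)
    (fun _ => P.fst.prod volume) (fun _ => volume)).symm _)

variable [MetricSpace X] [BorelSpace X]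

/-- Uniform concentration of the label sums over all neighbour sets of size `k`. -/
theorem measure_labels_le {P : Measure (X × Bool)} [IsProbabilityMeasure P]
    [TopologicalSpace.SeparableSpace X] [Nonempty X] {η : X → ℝ} (hη : IsCondProb P η) {d : ℕ}
    (hd : vcDim (augBalls X) = d) {k : ℕ} (hk : 0 < k) {t : ℝ} (ht : 0 < t) :
    sampleLaw P n {S | ∃ x j, (nearer S x j).card = k ∧
        t ≤ |∑ i ∈ nearer S x j, ((if (S i).1.2 = true then (1 : ℝ) else 0) - η (S i).1.1)|}
      ≤ ENNReal.ofReal (((n + 1) ^ d * ((n + 1) ^ d * (n * 2)) : ℕ)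
          * Real.exp (-2 * (t ^ 2 / k))) := by
  let W : WeightIndex n → Sample X n → ℝ := fun b S =>
    ∑ i, nnWeight b (fun i => ((S i).1.1, (S i).2)) i
      * ((if (S i).1.2 = true then (1 : ℝ) else 0) - η (S i).1.1)
  let V : WeightIndex n → Sample X n → ℝ := fun b S =>
    ∑ i, nnWeight b (fun i => ((S i).1.1, (S i).2)) i ^ 2
  let E : Set (Sample X n) := {S | ∃ b, 0 < W b S ∧ t ^ 2 / k * V b S ≤ W b S ^ 2}
  have hpt : Measurable fun (S : Sample X n) (i : Fin n) => ((S i).1.1, (S i).2) :=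
    measurable_pi_iff.2 fun i => (measurable_fst.comp (measurable_fst.comp
      (measurable_pi_apply i))).prodMk (measurable_snd.comp (measurable_pi_apply i))
  have ha : ∀ (b : WeightIndex n) i, Measurable fun S : Sample X n =>
      nnWeight b (fun i => ((S i).1.1, (S i).2)) i := fun b i =>
    (measurable_pi_apply i).comp ((measurable_nnWeight b).comp hpt)
  have hW : ∀ b, Measurable (W b) := by
    intro b
    refine Finset.measurable_sum _ fun i _ => (ha b i).mul (Measurable.sub ?_ ?_)
    · exact Measurable.ite ((measurable_snd.comp (measurable_fst.comp (measurable_pi_apply i)))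
        (MeasurableSet.singleton true)) measurable_const measurable_const
    · exact hη.measurable.comp (measurable_fst.comp (measurable_fst.comp (measurable_pi_apply i)))
  have hV : ∀ b, Measurable (V b) := fun b =>
    Finset.measurable_sum _ fun i _ => (ha b i).pow_const 2
  have hE : MeasurableSet E := by
    rw [show E = ⋃ b, {S | 0 < W b S ∧ t ^ 2 / k * V b S ≤ W b S ^ 2} from Set.ofPred_exists _]
    exact MeasurableSet.iUnion fun b => (measurableSet_lt measurable_const (hW b)).inter
      (measurableSet_le ((hV b).const_mul _) ((hW b).pow_const 2))
  have hsub : {S : Sample X n | ∃ x j, (nearer S x j).card = k ∧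
      t ≤ |∑ i ∈ nearer S x j, ((if (S i).1.2 = true then (1 : ℝ) else 0) - η (S i).1.1)|} ⊆ E := by
    rintro S ⟨x, j, hcard, hS⟩
    -- The sign in the weight turns the two-sided deviation into the one-sided event of the union
    -- bound.
    obtain ⟨sgn, hsgn⟩ : ∃ sgn : Bool, t ≤ (if sgn then 1 else -1) *
        ∑ i ∈ nearer S x j, ((if (S i).1.2 = true then (1 : ℝ) else 0) - η (S i).1.1) := by
      rcases le_abs.1 hS with h | h
      · exact ⟨true, by simpa using h⟩
      · exact ⟨false, by simpa using h⟩
    obtain ⟨b, hb⟩ := exists_nnWeight_eq S x j sgn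
    have hVb : V b S = k := by
      simp only [V, hb, ← hcard]
      cases sgn <;> simp
    have hWb : t ≤ W b S := by
      refine hsgn.trans_eq ?_
      simp only [W, hb, mul_assoc, ← Finset.mul_sum]
      simp
    refine ⟨b, ht.trans_le hWb, ?_⟩
    rw [hVb, div_mul_cancel₀ _ (by positivity)]
    gcongr
  refine (measure_mono hsub).trans ?_
  rw [← (measurePreserving_sample hη).measure_preimage hE.nullMeasurableSet]
  have h := measure_exists_bernDev_le (Measure.pi fun _ : Fin n => P.fst.prod volume)
    (a := nnWeight) (p := fun w i => η (w i).1) measurable_nnWeight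
    (measurable_pi_iff.2 fun i =>
      hη.measurable.comp (measurable_fst.comp (measurable_pi_apply i)))
    (fun w i => hη.mem_Icc _) (exists_finset_nnWeight hd) (t ^ 2 / k)
  refine le_trans (le_of_eq ?_) h
  congr 1
  ext q
  simp [E, W, V, bernDev]

end Labels

/-! ### Ghost sample and symmetrization for ball counts. -/

section Ghost

open ProbabilityTheory

variable {X : Type*} {n : ℕ}

/-- The number of points of a sample that lie in `C`. -/
def countIn (C : Set X) (xs : Fin n → X) : ℝ := ∑ i, C.indicator 1 (xs i)

/-- Exchange the two halves of the `i`-th pair unless `uᵢ < 1/2`. -/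
def swapPairs (u : Fin n → unitInterval) (w : Fin n → X × X) (i : Fin n) : X × X :=
  if (u i : ℝ) < 1 / 2 then w i else (w i).swap

/-- Difference of the indicators of `C` on the two halves of each pair. -/
def pairWeight (C : Set X) (w : Fin n → X × X) (i : Fin n) : ℝ :=
  C.indicator 1 (w i).2 - C.indicator 1 (w i).1

theorem two_mul_bernDev_pairWeight (C : Set X) (w : Fin n → X × X) (u : Fin n → unitInterval) :
    2 * bernDev (pairWeight C w) (fun _ => 1 / 2) u
      = countIn C (fun i => (swapPairs u w i).2) - countIn C (fun i => (swapPairs u w i).1) := by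
  rw [bernDev, countIn, countIn, ← Finset.sum_sub_distrib, Finset.mul_sum]
  refine Finset.sum_congr rfl fun i _ => ?_
  by_cases h : (u i : ℝ) < 1 / 2
  · simp only [swapPairs, pairWeight, h, if_true]; ring
  · simp only [swapPairs, pairWeight, h, if_false, Prod.fst_swap, Prod.snd_swap]; ring

theorem sum_sq_pairWeight_le (C : Set X) (w : Fin n → X × X) (u : Fin n → unitInterval) :
    ∑ i, pairWeight C w i ^ 2
      ≤ countIn C (fun i => (swapPairs u w i).1) + countIn C (fun i => (swapPairs u w i).2) := by
  rw [countIn, countIn, ← Finset.sum_add_distrib]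
  refine Finset.sum_le_sum fun i _ => ?_
  have key : pairWeight C w i ^ 2 ≤ C.indicator (1 : X → ℝ) (w i).1 + C.indicator 1 (w i).2 := by
    by_cases h1 : (w i).1 ∈ C <;> by_cases h2 : (w i).2 ∈ C <;> simp [pairWeight, h1, h2]
  by_cases h : (u i : ℝ) < 1 / 2
  · simpa only [swapPairs, h, if_true] using key
  · simpa only [swapPairs, h, if_false, Prod.fst_swap, Prod.snd_swap, add_comm] using key

theorem exists_finset_pairWeight [MetricSpace X] [Nonempty X]
    [TopologicalSpace.SeparableSpace X] {d : ℕ} (hd : vcDim (augBalls X) = d) {ι : Type*}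
    (c : ι → ℕ × ℚ) (w : Fin n → X × X) :
    ∃ F : Finset (Fin n → ℝ), F.card ≤ (n + n + 1) ^ d ∧
      ∀ b, pairWeight (ratBall X (c b)) w ∈ F := by
  classical
  let g : Finset (Fin n ⊕ Fin n) → Fin n → ℝ := fun T i =>
    (if Sum.inr i ∈ T then 1 else 0) - (if Sum.inl i ∈ T then 1 else 0)
  let p : Fin n ⊕ Fin n → X := Sum.elim (fun i => (w i).1) (fun i => (w i).2)
  refine ⟨(ballTraces p).image g, ?_, fun b => ?_⟩
  · refine Finset.card_image_le.trans ?_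
    simpa using card_ballTraces_le hd p
  · refine Finset.mem_image.2 ⟨_, filter_ratBall_mem_ballTraces p (c b), ?_⟩
    ext i
    simp [g, p, pairWeight, Set.indicator_apply]

variable [MeasurableSpace X]

theorem measurable_countIn {C : Set X} (hC : MeasurableSet C) :
    Measurable (countIn C : (Fin n → X) → ℝ) :=
  Finset.measurable_sum _ fun i _ => (measurable_one.indicator hC).comp (measurable_pi_apply i)

/-- Chebyshev's inequality: at least half of the samples put about `k` points into a set of mass
at least `k / n`. -/
theorem half_le_measure_countIn (μ : Measure X) [IsProbabilityMeasure μ] {C : Set X}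
    (hC : MeasurableSet C) {k t : ℝ} (hk : 1 ≤ k) (hkC : k ≤ n * μ.real C) (ht : 0 < t)
    (hkt : 8 * k ≤ t ^ 2) :
    2⁻¹ ≤ (Measure.pi fun _ : Fin n => μ) {xs | k - t / 2 ≤ countIn C xs} := by
  set Q := Measure.pi fun _ : Fin n => μ
  set f : X → ℝ := C.indicator 1 with hf
  have hfm : Measurable f := measurable_one.indicator hC
  have hfL : MemLp f 2 μ := (memLp_const (1 : ℝ)).indicator hC
  have hfi : ∫ x, f x ∂μ = μ.real C := by rw [hf, integral_indicator_one hC]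
  have hmp : ∀ i : Fin n, MeasurePreserving (fun xs : Fin n → X => xs i) Q μ :=
    measurePreserving_eval (fun _ : Fin n => μ)
  have hL : ∀ i : Fin n, MemLp (fun xs : Fin n → X => f (xs i)) 2 Q := fun i =>
    hfL.comp_measurePreserving (hmp i)
  have hcL : MemLp (countIn C : (Fin n → X) → ℝ) 2 Q := memLp_finsetSum _ fun i _ => hL i
  have hmean : ∫ xs, countIn C xs ∂Q = n * μ.real C := by
    unfold countIn
    rw [integral_finsetSum _ fun i _ => (hL i).integrable one_le_two]
    have : ∀ i : Fin n, ∫ xs, C.indicator (1 : X → ℝ) (xs i) ∂Q = μ.real C := fun i => by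
      rw [← hfi, ← (hmp i).map_eq, integral_map (hmp i).aemeasurable hfm.aestronglyMeasurable]
    rw [Finset.sum_congr rfl fun i _ => this i]
    simp
  have hvar : Var[(countIn C : (Fin n → X) → ℝ); Q] ≤ n * μ.real C := by
    have h1 : (countIn C : (Fin n → X) → ℝ) = ∑ i, fun xs : Fin n → X => f (xs i) := by
      ext xs; simp [countIn, hf]
    rw [h1, variance_sum_pi fun _ => hfL]
    have h2 : Var[f; μ] ≤ μ.real C := by
      refine (variance_le_expectation_sq hfm.aestronglyMeasurable).trans_eq ?_
      rw [← hfi]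
      congr 1
      ext x
      by_cases hx : x ∈ C <;> simp [hf, hx]
    calc _ ≤ ∑ _i : Fin n, μ.real C := Finset.sum_le_sum fun _ _ => h2
      _ = _ := by simp
  set m := n * μ.real C
  have hc : 0 < m - k + t / 2 := by linarith
  have ht2 : 2 ≤ t := by nlinarith
  have hcheb := meas_ge_le_variance_div_sq hcL hc
  rw [hmean] at hcheb
  -- Expanding the square, `(m - k) t ≥ 2 (m - k)` and `t ^ 2 / 4 ≥ 2 k`, so it is at least `2 m`.
  have hbound : Var[(countIn C : (Fin n → X) → ℝ); Q] / (m - k + t / 2) ^ 2 ≤ 2⁻¹ := by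
    rw [div_le_iff₀ (by positivity)]
    nlinarith [sq_nonneg (m - k), mul_nonneg (sub_nonneg.2 hkC) (sub_nonneg.2 ht2)]
  have hbad : Q {xs | k - t / 2 ≤ countIn C xs}ᶜ ≤ 2⁻¹ := by
    calc _ ≤ Q {xs | m - k + t / 2 ≤ |countIn C xs - m|} := by
          refine measure_mono fun xs hxs => ?_
          have hxs' : countIn C xs < k - t / 2 := not_le.1 hxs
          show m - k + t / 2 ≤ |countIn C xs - m|
          rw [abs_sub_comm]
          exact le_trans (by linarith) (le_abs_self _)
      _ ≤ _ := hcheb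
      _ ≤ ENNReal.ofReal 2⁻¹ := ENNReal.ofReal_le_ofReal hbound
      _ = 2⁻¹ := by rw [ENNReal.ofReal_inv_of_pos two_pos]; simp
  have hms : MeasurableSet {xs : Fin n → X | k - t / 2 ≤ countIn C xs} :=
    measurableSet_le measurable_const (measurable_countIn hC)
  have hsum := prob_add_prob_compl (μ := Q) hms
  by_contra! hlt
  have : Q {xs | k - t / 2 ≤ countIn C xs} + Q {xs | k - t / 2 ≤ countIn C xs}ᶜ < 1 := by
    rw [← ENNReal.inv_two_add_inv_two]
    exact ENNReal.add_lt_add_of_lt_of_le (by simp) hlt hbad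
  exact this.ne hsum

theorem measurePreserving_swapPairs (μ : Measure X) [IsProbabilityMeasure μ]
    (u : Fin n → unitInterval) :
    MeasurePreserving (swapPairs u) (Measure.pi fun _ => μ.prod μ)
      (Measure.pi fun _ => μ.prod μ) := by
  refine measurePreserving_pi (fun _ => μ.prod μ) (fun _ => μ.prod μ)
    (f := fun i (q : X × X) => if (u i : ℝ) < 1 / 2 then q else q.swap) fun i => ?_
  by_cases h : (u i : ℝ) < 1 / 2
  · simp only [h, if_true]
    exact MeasurePreserving.id _
  · simp only [h, if_false]
    exact Measure.measurePreserving_swap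

theorem measurable_swapPairs :
    Measurable fun q : (Fin n → X × X) × (Fin n → unitInterval) => swapPairs q.2 q.1 := by
  refine measurable_pi_iff.2 fun i => ?_
  have hw : Measurable fun q : (Fin n → X × X) × (Fin n → unitInterval) => q.1 i :=
    (measurable_pi_apply i).comp measurable_fst
  exact Measurable.ite (measurableSet_lt (measurable_subtype_coe.comp
    ((measurable_pi_apply i).comp measurable_snd)) measurable_const) hw (measurable_swap.comp hw)

/-- Randomizing the two halves of each pair does not change the law of a sample of pairs. -/
theorem measure_swapPairs_preimage (μ : Measure X) [IsProbabilityMeasure μ]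
    {B : Set (Fin n → X × X)} (hB : MeasurableSet B) :
    ((Measure.pi fun _ => μ.prod μ).prod (uniformLaw n)) {q | swapPairs q.2 q.1 ∈ B}
      = (Measure.pi fun _ => μ.prod μ) B := by
  have hm : MeasurableSet {q : (Fin n → X × X) × (Fin n → unitInterval) | swapPairs q.2 q.1 ∈ B} :=
    measurable_swapPairs hB
  rw [Measure.prod_apply_symm hm]
  have : ∀ u, (Measure.pi fun _ : Fin n => μ.prod μ)
      ((fun w => (w, u)) ⁻¹' {q | swapPairs q.2 q.1 ∈ B})
        = (Measure.pi fun _ => μ.prod μ) B := fun u =>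
    (measurePreserving_swapPairs μ u).measure_preimage hB.nullMeasurableSet
  rw [lintegral_congr this]
  simp

/-- If `x + y ≤ 4k`, the gap `t/2` suffices. Otherwise `x < k` forces `y - x ≥ (x + y)/2`, and `t ≤
k` finishes. It converts a gap between the two counts into the self-normalized deviation of
`measure_exists_bernDev_le`. -/
theorem sq_mul_add_le_of_gap {k t x y : ℝ} (hk : 0 < k) (ht : 0 < t) (htk : t ≤ k)
    (hx : x < k - t) (hy : k - t / 2 ≤ y) :
    t ^ 2 / (64 * k) * (x + y) ≤ ((y - x) / 2) ^ 2 := by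
  have hD : t / 2 ≤ y - x := by linarith
  rw [div_mul_eq_mul_div, div_le_iff₀ (by positivity)]
  rcases le_or_gt (x + y) (4 * k) with hN | hN
  · have h1 : t ^ 2 * (x + y) ≤ t ^ 2 * (4 * k) := by gcongr
    have h2 : (t / 2) ^ 2 ≤ (y - x) ^ 2 := by gcongr
    nlinarith
  · have h1 : (x + y) / 2 ≤ y - x := by linarith
    have h2 : ((x + y) / 2) ^ 2 ≤ (y - x) ^ 2 := by
      have : 0 ≤ (x + y) / 2 := by linarith
      gcongr
    have h3 : t ^ 2 * (x + y) ≤ k ^ 2 * (x + y) := by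
      have : 0 ≤ x + y := by linarith
      gcongr
    nlinarith [mul_pos hk (show 0 < x + y by linarith)]

variable [MetricSpace X] [BorelSpace X] [Nonempty X] [TopologicalSpace.SeparableSpace X]

/-- With high probability every ball of mass at least `k / n` contains nearly `k` sample points. -/
theorem measure_lowCount_le (μ : Measure X) [IsProbabilityMeasure μ] {d : ℕ}
    (hd : vcDim (augBalls X) = d) {k t : ℝ} (hk : 1 ≤ k) (ht : 0 < t) (htk : t ≤ k)
    (hkt : 8 * k ≤ t ^ 2) :
    (Measure.pi fun _ : Fin n => μ)
        {xs | ∃ b, k ≤ n * μ.real (ratBall X b) ∧ countIn (ratBall X b) xs < k - t}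
      ≤ ENNReal.ofReal (2 * (((n + n + 1) ^ d : ℕ) * Real.exp (-2 * (t ^ 2 / (64 * k))))) := by
  set Q := Measure.pi fun _ : Fin n => μ
  set R := Measure.pi fun _ : Fin n => μ.prod μ
  let ι := {b : ℕ × ℚ // k ≤ n * μ.real (ratBall X b)}
  have hcnt : ∀ b, Measurable (countIn (ratBall X b) : (Fin n → X) → ℝ) := fun b =>
    measurable_countIn (measurableSet_ratBall b)
  let A : Set (Fin n → X) := {xs | ∃ b : ι, countIn (ratBall X b.1) xs < k - t}
  let B : Set ((Fin n → X) × (Fin n → X)) :=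
    {q | ∃ b : ι, countIn (ratBall X b.1) q.1 < k - t ∧ k - t / 2 ≤ countIn (ratBall X b.1) q.2}
  have hA : MeasurableSet A := by
    rw [show A = ⋃ b : ι, {xs | countIn (ratBall X b.1) xs < k - t} from Set.ofPred_exists _]
    exact MeasurableSet.iUnion fun b => measurableSet_lt (hcnt _) measurable_const
  have hB : MeasurableSet B := by
    rw [show B = ⋃ b : ι, {q | countIn (ratBall X b.1) q.1 < k - t ∧
      k - t / 2 ≤ countIn (ratBall X b.1) q.2} from Set.ofPred_exists _]
    exact MeasurableSet.iUnion fun b => (measurableSet_lt ((hcnt _).comp measurable_fst)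
      measurable_const).inter (measurableSet_le measurable_const ((hcnt _).comp measurable_snd))
  -- For each bad sample, fix one bad ball: an independent ghost sample fills it with probability at
  -- least one half.
  have hhalf : 2⁻¹ * Q A ≤ (Q.prod Q) B := by
    rw [Measure.prod_apply hB, ← setLIntegral_const]
    refine (setLIntegral_mono' hA fun xs hxs => ?_).trans (setLIntegral_le_lintegral A _)
    obtain ⟨b, hb⟩ := hxs
    refine (half_le_measure_countIn μ (measurableSet_ratBall b.1) hk b.2 ht hkt).trans
      (measure_mono fun ys hys => ⟨b, hb, hys⟩)
  have hpair := measurePreserving_arrowProdEquivProdArrow X X (Fin n) (fun _ => μ) (fun _ => μ)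
  let B' : Set (Fin n → X × X) := MeasurableEquiv.arrowProdEquivProdArrow X X (Fin n) ⁻¹' B
  have hB' : MeasurableSet B' := hpair.measurable hB
  have hBR : (Q.prod Q) B = (R.prod (uniformLaw n)) {q | swapPairs q.2 q.1 ∈ B'} := by
    rw [measure_swapPairs_preimage μ hB']
    exact (hpair.measure_preimage hB.nullMeasurableSet).symm
  have hbound : (Q.prod Q) B
      ≤ ENNReal.ofReal (((n + n + 1) ^ d : ℕ) * Real.exp (-2 * (t ^ 2 / (64 * k)))) := by
    rw [hBR]
    refine (measure_mono ?_).trans (measure_exists_bernDev_le R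
      (a := fun b : ι => pairWeight (ratBall X b.1)) (p := fun _ _ => 1 / 2)
      (fun b => measurable_pi_iff.2 fun i => ?_) measurable_const (fun _ _ => by norm_num)
      (exists_finset_pairWeight hd fun b : ι => b.1) (t ^ 2 / (64 * k)))
    · rintro ⟨w, u⟩ ⟨b, hb1, hb2⟩
      replace hb1 : countIn (ratBall X b.1) (fun i => (swapPairs u w i).1) < k - t := hb1
      replace hb2 : k - t / 2 ≤ countIn (ratBall X b.1) (fun i => (swapPairs u w i).2) := hb2
      have hW := two_mul_bernDev_pairWeight (ratBall X b.1) w u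
      have hV := sum_sq_pairWeight_le (ratBall X b.1) w u
      have hgap := sq_mul_add_le_of_gap (by linarith) ht htk hb1 hb2
      have hW' : bernDev (pairWeight (ratBall X b.1) w) (fun _ => 1 / 2) u
          = (countIn (ratBall X b.1) (fun i => (swapPairs u w i).2)
            - countIn (ratBall X b.1) (fun i => (swapPairs u w i).1)) / 2 := by linarith
      refine ⟨b, ?_, ?_⟩
      · show 0 < bernDev (pairWeight (ratBall X b.1) w) (fun _ => 1 / 2) u
        linarith
      · show _ ≤ bernDev (pairWeight (ratBall X b.1) w) (fun _ => 1 / 2) u ^ 2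
        rw [hW']
        exact (mul_le_mul_of_nonneg_left hV (by positivity)).trans hgap
    · have h1 : Measurable ((ratBall X b.1).indicator (1 : X → ℝ)) :=
        measurable_one.indicator (measurableSet_ratBall b.1)
      exact (h1.comp (measurable_snd.comp (measurable_pi_apply i))).sub
        (h1.comp (measurable_fst.comp (measurable_pi_apply i)))
  have hsub : {xs : Fin n → X | ∃ b, k ≤ n * μ.real (ratBall X b) ∧
      countIn (ratBall X b) xs < k - t} ⊆ A := by
    rintro xs ⟨b, hb, hb'⟩
    exact ⟨⟨b, hb⟩, hb'⟩
  calc _ ≤ Q A := measure_mono hsub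
    _ = 2 * (2⁻¹ * Q A) := by
      rw [← mul_assoc, ENNReal.mul_inv_cancel two_ne_zero ENNReal.ofNat_ne_top, one_mul]
    _ ≤ 2 * ENNReal.ofReal (((n + n + 1) ^ d : ℕ) * Real.exp (-2 * (t ^ 2 / (64 * k)))) := by
      gcongr
      exact hhalf.trans hbound
    _ = _ := by
      rw [ENNReal.ofReal_mul two_pos.le]
      simp

/-- Replacing a ball by a larger rational one with the same trace keeps the count and cannot lower
the mass. -/
theorem measure_sample_lowCount_le {P : Measure (X × Bool)} [IsProbabilityMeasure P] {d : ℕ}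
    (hd : vcDim (augBalls X) = d) {k t : ℝ} (hk : 1 ≤ k) (ht : 0 < t) (htk : t ≤ k)
    (hkt : 8 * k ≤ t ^ 2) :
    sampleLaw P n {S | ∃ x r, k ≤ n * P.fst.real (Metric.closedBall x r) ∧
        countIn (Metric.closedBall x r) (fun i => (S i).1.1) < k - t}
      ≤ ENNReal.ofReal (2 * (((n + n + 1) ^ d : ℕ) * Real.exp (-2 * (t ^ 2 / (64 * k))))) := by
  have hfst : MeasurePreserving (Prod.fst : X × Bool → X) P P.fst := ⟨measurable_fst, rfl⟩
  have hmp := measurePreserving_pi (fun _ : Fin n => P.prod (volume : Measure unitInterval))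
    (fun _ => P.fst) (fun _ => hfst.comp measurePreserving_fst)
  have hmeas : MeasurableSet {xs : Fin n → X | ∃ b, k ≤ n * P.fst.real (ratBall X b) ∧
      countIn (ratBall X b) xs < k - t} := by
    rw [Set.ofPred_exists]
    exact MeasurableSet.iUnion fun b => (MeasurableSet.const _).inter (measurableSet_lt
      (measurable_countIn (measurableSet_ratBall b)) measurable_const)
  refine le_trans ?_ (measure_lowCount_le P.fst hd hk ht htk hkt)
  rw [← hmp.measure_preimage hmeas.nullMeasurableSet]
  refine measure_mono ?_
  rintro S ⟨x, r, hx, hS⟩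
  obtain ⟨b, hb, hb'⟩ := exists_ratBall_closed (fun i => (S i).1.1) x r
  refine ⟨b, hx.trans ?_, lt_of_eq_of_lt ?_ hS⟩
  · exact mul_le_mul_of_nonneg_left (measureReal_mono hb) (Nat.cast_nonneg n)
  · classical
    refine Finset.sum_congr rfl fun i _ => ?_
    rw [Set.indicator_apply, Set.indicator_apply]
    exact if_congr (hb' i) rfl rfl

end Ghost

/-! ### Masses of balls and consequences of smoothness. -/

section Balls

variable {X : Type*} [MetricSpace X] [MeasurableSpace X]

/-- The mass of an open ball is the limit of the masses of smaller closed balls. -/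
theorem measureReal_ball_le (μ : Measure X) [IsFiniteMeasure μ] {x : X} {r p : ℝ} (hp : 0 ≤ p)
    (h : ∀ s, 0 ≤ s → s < r → μ.real (Metric.closedBall x s) ≤ p) :
    μ.real (Metric.ball x r) ≤ p := by
  have hU : Metric.ball x r = ⋃ m : ℕ, Metric.closedBall x (r - 1 / (m + 1)) := by
    ext y
    simp only [Metric.mem_ball, Set.mem_iUnion, Metric.mem_closedBall]
    constructor
    · intro hy
      obtain ⟨m, hm⟩ := exists_nat_one_div_lt (sub_pos.2 hy)
      exact ⟨m, by linarith⟩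
    · rintro ⟨m, hm⟩
      have : (0 : ℝ) < 1 / (m + 1) := by positivity
      linarith
  have hmono : Monotone fun m : ℕ => Metric.closedBall x (r - 1 / ((m : ℝ) + 1)) := fun a b hab =>
    Metric.closedBall_subset_closedBall (by gcongr)
  rw [measureReal_def]
  refine ENNReal.toReal_le_of_le_ofReal hp ?_
  rw [hU, hmono.measure_iUnion]
  refine iSup_le fun m => ?_
  rcases lt_or_ge (r - 1 / ((m : ℝ) + 1)) 0 with hs | hs
  · rw [Metric.closedBall_eq_empty.2 hs, measure_empty]
    exact zero_le
  · refine (ENNReal.le_ofReal_iff_toReal_le (measure_ne_top _ _) hp).2 (h _ hs ?_)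
    have : (0 : ℝ) < 1 / (m + 1) := by positivity
    linarith

/-- The radius is the infimum of those whose closed ball has mass at least `p`: continuity from
above gives the first bound, continuity from below the second. Spheres may carry mass, so equality
is not available; `p < 1` makes the infimum range over a nonempty set. -/
theorem exists_ball_mass_bracket [BorelSpace X] (μ : Measure X) [IsProbabilityMeasure μ] (x : X)
    {p : ℝ} (hp : 0 ≤ p) (hp1 : p < 1) :
    ∃ r, p ≤ μ.real (Metric.closedBall x r) ∧ μ.real (Metric.ball x r) ≤ p := by
  set T : Set ℝ := {r | 0 ≤ r ∧ p ≤ μ.real (Metric.closedBall x r)} with hT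
  have hbdd : BddBelow T := ⟨0, fun r hr => hr.1⟩
  have hne : T.Nonempty := by
    by_contra hemp
    have hall : ∀ m : ℕ, μ (Metric.closedBall x m) ≤ ENNReal.ofReal p := fun m => by
      refine (ENNReal.le_ofReal_iff_toReal_le (measure_ne_top _ _) hp).2 ?_
      by_contra hm
      exact hemp ⟨m, Nat.cast_nonneg m, (not_le.1 hm).le⟩
    have hmono : Monotone fun m : ℕ => Metric.closedBall x (m : ℝ) := fun a b hab =>
      Metric.closedBall_subset_closedBall (by exact_mod_cast hab)
    have h1 := hmono.measure_iUnion (μ := μ)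
    rw [Metric.iUnion_closedBall_nat, measure_univ] at h1
    have h2 : (1 : ℝ≥0∞) ≤ ENNReal.ofReal p := h1.trans_le (iSup_le hall)
    rw [ENNReal.one_le_ofReal] at h2
    linarith
  refine ⟨sInf T, ?_, ?_⟩
  · have hI : Metric.closedBall x (sInf T)
        = ⋂ m : ℕ, Metric.closedBall x (sInf T + 1 / (m + 1)) := by
      ext y
      simp only [Metric.mem_closedBall, Set.mem_iInter]
      constructor
      · intro hy m
        have : (0 : ℝ) < 1 / (m + 1) := by positivity
        linarith
      · intro hy
        by_contra hlt
        obtain ⟨m, hm⟩ := exists_nat_one_div_lt (sub_pos.2 (not_le.1 hlt))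
        linarith [hy m]
    have hanti : Antitone fun m : ℕ => Metric.closedBall x (sInf T + 1 / ((m : ℝ) + 1)) :=
      fun a b hab => Metric.closedBall_subset_closedBall (by gcongr)
    rw [measureReal_def, ← ENNReal.ofReal_le_iff_le_toReal (measure_ne_top _ _), hI,
      hanti.measure_iInter (fun _ => Metric.isClosed_closedBall.measurableSet.nullMeasurableSet)
        ⟨0, measure_ne_top _ _⟩]
    refine le_iInf fun m => ?_
    rw [ENNReal.ofReal_le_iff_le_toReal (measure_ne_top _ _)]
    obtain ⟨t, ht, htlt⟩ := exists_lt_of_csInf_lt hne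
      (show sInf T < sInf T + 1 / ((m : ℝ) + 1) from lt_add_of_pos_right _ (by positivity))
    exact ht.2.trans (measureReal_mono (Metric.closedBall_subset_closedBall htlt.le))
  · refine measureReal_ball_le μ hp fun s hs hlt => ?_
    by_contra hps
    exact absurd (csInf_le hbdd ⟨hs, (not_le.1 hps).le⟩) (not_le.2 hlt)

theorem measureReal_ball_le_of_le_probRadius (μ : Measure X) [IsFiniteMeasure μ] {x : X} {r : ℝ≥0}
    {p : ℝ} (hp : 0 ≤ p) (hr : (r : ℝ≥0∞) ≤ probRadius μ x p) : μ.real (Metric.ball x r) ≤ p := by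
  refine measureReal_ball_le μ hp fun s hs hlt => ?_
  lift s to ℝ≥0 using hs
  by_contra hps
  have h1 : probRadius μ x p ≤ s := iInf₂_le s (not_le.1 hps).le
  exact absurd (NNReal.coe_le_coe.2 (ENNReal.coe_le_coe.1 (hr.trans h1))) (not_le.2 hlt)

/-- Since smoothness is stated through open balls, the open-ball mass controls `η` on the sphere as
well. -/
theorem IsSmooth.abs_sub_le {μ : Measure X} [IsFiniteMeasure μ] {η : X → ℝ} {α L : ℝ}
    (h : IsSmooth μ η α L) (hα : 0 < α) (hL : 0 < L) {x y : X} {r q : ℝ}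
    (hq : μ.real (Metric.ball x r) ≤ q) (hy : dist y x ≤ r) : |η y - η x| ≤ L * q ^ α := by
  rw [abs_sub_comm]
  refine (h x y).trans (mul_le_mul_of_nonneg_left ?_ hL.le)
  refine Real.rpow_le_rpow measureReal_nonneg (le_trans (measureReal_mono ?_) hq) hα.le
  exact Metric.ball_subset_ball (by rwa [dist_comm])

/-- Near the effective decision boundary a smooth `η` is close to `1/2`. -/
theorem abs_sub_half_le_of_mem_effBoundary [BorelSpace X] {μ : Measure X} [IsFiniteMeasure μ]
    {η : X → ℝ} (hη : Measurable η) (hη' : ∀ x, η x ∈ Set.Icc (0 : ℝ) 1) {α L : ℝ}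
    (h : IsSmooth μ η α L) (hα : 0 < α) (hL : 0 < L) {p Δ : ℝ} (hp : 0 ≤ p) (hΔ : 0 ≤ Δ) {x : X}
    (hx : x ∈ effBoundary μ η p Δ) : |η x - 1 / 2| ≤ Δ + L * p ^ α := by
  have hLp : 0 ≤ L * p ^ α := mul_nonneg hL.le (Real.rpow_nonneg hp α)
  have havg : ∀ r : ℝ≥0, (r : ℝ≥0∞) ≤ probRadius μ x p → 0 < μ (Metric.closedBall x r) →
      (⨍ y in Metric.closedBall x r, η y ∂μ) ∈ Set.Icc (η x - L * p ^ α) (η x + L * p ^ α) := by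
    intro r hr hpos
    have hball := measureReal_ball_le_of_le_probRadius μ hp hr
    refine (convex_Icc _ _).set_average_mem isClosed_Icc hpos.ne' (measure_ne_top _ _) ?_ ?_
    · refine ae_restrict_of_forall_mem Metric.isClosed_closedBall.measurableSet fun y hy => ?_
      have := abs_le.1 (h.abs_sub_le hα hL hball hy)
      exact ⟨by linarith, by linarith⟩
    · refine Integrable.of_bound hη.aestronglyMeasurable 1 (Filter.Eventually.of_forall fun y => ?_)
      rw [Real.norm_eq_abs, abs_of_nonneg (hη' y).1]
      exact (hη' y).2
  simp only [effBoundary, effInteriorPos, effInteriorNeg, Set.mem_compl_iff, Set.mem_union,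
    Set.mem_ofPred_eq, not_or, not_and, not_forall, not_le] at hx
  rcases lt_trichotomy (η x) (1 / 2) with hlt | heq | hgt
  · obtain ⟨r, hr, hpos, hav⟩ := hx.2 hlt
    have := havg r hr hpos
    rw [abs_le]
    constructor <;> linarith [this.2]
  · rw [heq, sub_self, abs_zero]
    linarith
  · obtain ⟨r, hr, hpos, hav⟩ := hx.1 hgt
    have := havg r hr hpos
    rw [abs_le]
    constructor <;> linarith [this.1]

end Balls

/-! ### Deviation of the vote from `η` on the good event. -/

section Vote

variable {X : Type*} [MetricSpace X] {n k : ℕ}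

theorem knnVote_mem_Icc (hk : k < n) (S : Sample X n) (x : X) :
    knnVote k S x ∈ Set.Icc (0 : ℝ) 1 := by
  obtain ⟨j, hcard, hv⟩ := exists_knnVote_eq hk S x
  rw [hv, one_div_mul_eq_div]
  refine ⟨by positivity, div_le_one_of_le₀ ?_ (Nat.cast_nonneg k)⟩
  rw [← hcard, Finset.card_eq_sum_ones, Nat.cast_sum]
  exact Finset.sum_le_sum fun i _ => by split_ifs <;> simp

/-- If nearly `k` sample points lie in a ball, few of the `k` nearest neighbours lie outside. -/
theorem card_nearer_outside_le {S : Sample X n} {x : X} {j : Fin n}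
    (hcard : (nearer S x j).card = k) {r t : ℝ} (ht : 0 ≤ t)
    (hcount : k - t ≤ countIn (Metric.closedBall x r) (fun i => (S i).1.1))
    [DecidablePred fun i => dist (S i).1.1 x ≤ r] :
    (((nearer S x j).filter fun i => ¬ dist (S i).1.1 x ≤ r).card : ℝ) ≤ t := by
  rcases ((nearer S x j).filter fun i => ¬ dist (S i).1.1 x ≤ r).eq_empty_or_nonempty with h | h
  · rw [h, Finset.card_empty, Nat.cast_zero]
    exact ht
  obtain ⟨i₀, hi₀⟩ := h
  rw [Finset.mem_filter, mem_nearer] at hi₀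
  have hj : dist (S i₀).1.1 x ≤ dist (S j).1.1 x := hi₀.1.elim le_of_lt fun h => h.1
  -- Once a neighbour lies outside the ball, every sample point inside precedes it and is itself a
  -- neighbour.
  have hsub : (Finset.univ.filter fun i => dist (S i).1.1 x ≤ r)
      ⊆ (nearer S x j).filter fun i => dist (S i).1.1 x ≤ r := by
    intro i hi
    rw [Finset.mem_filter] at hi ⊢
    exact ⟨mem_nearer.2 (Or.inl (by linarith [hi.2, not_le.1 hi₀.2])), hi.2⟩
  have hM : countIn (Metric.closedBall x r) (fun i => (S i).1.1)
      = ((Finset.univ.filter fun i => dist (S i).1.1 x ≤ r).card : ℝ) := by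
    classical
    rw [Finset.card_filter, Nat.cast_sum, countIn]
    refine Finset.sum_congr rfl fun i _ => ?_
    by_cases hi : dist (S i).1.1 x ≤ r <;> simp [hi]
  have hle : ((Finset.univ.filter fun i => dist (S i).1.1 x ≤ r).card : ℝ)
      ≤ ((nearer S x j).filter fun i => dist (S i).1.1 x ≤ r).card := by
    exact_mod_cast Finset.card_le_card hsub
  have hsplit : (((nearer S x j).filter fun i => dist (S i).1.1 x ≤ r).card : ℝ)
      + ((nearer S x j).filter fun i => ¬ dist (S i).1.1 x ≤ r).card = k := by
    rw [← hcard]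
    exact_mod_cast Finset.card_filter_add_card_filter_not _
  linarith

variable [MeasurableSpace X] [BorelSpace X]

theorem abs_knnVote_sub_le {μ : Measure X} [IsProbabilityMeasure μ] {η : X → ℝ}
    (hη' : ∀ x, η x ∈ Set.Icc (0 : ℝ) 1) {α L : ℝ} (h : IsSmooth μ η α L) (hα : 0 < α) (hL : 0 < L)
    (hk0 : 0 < k) (hk : k < n) {t₁ t₂ : ℝ} (ht₂ : 0 ≤ t₂) (S : Sample X n) (x : X)
    (hlab : ∀ j, (nearer S x j).card = k →
      |∑ i ∈ nearer S x j, ((if (S i).1.2 = true then (1 : ℝ) else 0) - η (S i).1.1)| ≤ t₁)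
    (hcount : ∀ r, k ≤ n * μ.real (Metric.closedBall x r) →
      k - t₂ ≤ countIn (Metric.closedBall x r) (fun i => (S i).1.1)) :
    |knnVote k S x - η x| ≤ (t₁ + t₂) / k + L * ((k : ℝ) / n) ^ α := by
  classical
  obtain ⟨j, hcard, hv⟩ := exists_knnVote_eq hk S x
  have hn0 : (0 : ℝ) < n := by exact_mod_cast hk0.trans hk
  have hk0' : (0 : ℝ) < k := by exact_mod_cast hk0
  obtain ⟨r, hr, hr'⟩ := exists_ball_mass_bracket μ x (p := (k : ℝ) / n) (by positivity)
    ((div_lt_one hn0).2 (by exact_mod_cast hk))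
  have hout := card_nearer_outside_le hcard ht₂ (hcount r (by rwa [div_le_iff₀' hn0] at hr))
  set T := nearer S x j
  have hLq : 0 ≤ L * ((k : ℝ) / n) ^ α := by positivity
  have hin : |∑ i ∈ T, (η (S i).1.1 - η x)| ≤ k * (L * ((k : ℝ) / n) ^ α) + t₂ := by
    calc _ ≤ ∑ i ∈ T, |η (S i).1.1 - η x| := Finset.abs_sum_le_sum_abs _ _
      _ ≤ ∑ i ∈ T, (L * ((k : ℝ) / n) ^ α + if ¬ dist (S i).1.1 x ≤ r then 1 else 0) := by
          refine Finset.sum_le_sum fun i _ => ?_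
          by_cases hi : dist (S i).1.1 x ≤ r
          · simpa [hi] using h.abs_sub_le hα hL hr' hi
          · have h1 := hη' (S i).1.1
            have h2 := hη' x
            have : |η (S i).1.1 - η x| ≤ 1 := abs_le.2 ⟨by linarith [h1.1, h2.2], by
              linarith [h1.2, h2.1]⟩
            simp only [hi, not_false_eq_true, if_true]
            linarith
      _ = k * (L * ((k : ℝ) / n) ^ α)
          + (T.filter fun i => ¬ dist (S i).1.1 x ≤ r).card := by
          rw [Finset.sum_add_distrib, Finset.sum_const, hcard, nsmul_eq_mul, Finset.sum_boole]
      _ ≤ _ := by gcongr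
  have hdecomp : knnVote k S x - η x = (∑ i ∈ T, ((if (S i).1.2 = true then (1 : ℝ) else 0)
      - η (S i).1.1) + ∑ i ∈ T, (η (S i).1.1 - η x)) / k := by
    rw [← Finset.sum_add_distrib, hv, eq_div_iff hk0'.ne', sub_mul, mul_comm (1 / (k : ℝ)),
      mul_assoc, one_div_mul_cancel hk0'.ne']
    simp only [sub_add_sub_cancel, Finset.sum_sub_distrib, Finset.sum_const, hcard, nsmul_eq_mul]
    ring
  rw [hdecomp, abs_div, abs_of_pos hk0', div_le_iff₀ hk0', add_mul, div_mul_cancel₀ _ hk0'.ne']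
  calc _ ≤ t₁ + (k * (L * ((k : ℝ) / n) ^ α) + t₂) :=
        (abs_add_le _ _).trans (add_le_add (hlab j hcard) hin)
    _ = _ := by ring

end Vote

/-! ### Constants. -/

section Numeric

theorem log_two_div_le {d n : ℕ} (hd : 1 ≤ d) (hn : 2 ≤ n) {δ : ℝ} (hδ : 0 < δ) :
    Real.log (2 / δ) ≤ d * Real.log n + Real.log (1 / δ) := by
  rw [Real.log_div two_ne_zero hδ.ne', Real.log_div one_ne_zero hδ.ne', Real.log_one]
  have h1 : Real.log 2 ≤ Real.log n := Real.log_le_log two_pos (by exact_mod_cast hn)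
  have h2 : (1 : ℝ) ≤ d := by exact_mod_cast hd
  have h3 : 0 ≤ Real.log 2 := Real.log_nonneg one_le_two
  nlinarith

/-- With `u = n ^ d ≥ 2` the exponentials are powers of `δ / u`, while the trace counts are at most
powers of `u`, because `n + 1 ≤ n ^ 2` and `2 n + 1 ≤ n ^ 3`. -/
theorem union_bound_le {d n : ℕ} (hd : 1 ≤ d) (hn : 2 ≤ n) {δ : ℝ} (hδ : 0 < δ) (hδ1 : δ < 1) :
    (((n + 1) ^ d * ((n + 1) ^ d * (n * 2)) : ℕ) : ℝ)
        * Real.exp (-18 * (d * Real.log n + Real.log (1 / δ)))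
      + 2 * (((n + n + 1) ^ d : ℕ) * Real.exp (-12 * (d * Real.log n + Real.log (1 / δ))))
      ≤ δ ^ 2 / 16 := by
  have hn0 : (0 : ℝ) < n := by positivity
  have hn2 : (2 : ℝ) ≤ n := by exact_mod_cast hn
  set u : ℝ := (n : ℝ) ^ d with hu
  have hnu : (n : ℝ) ≤ u := le_self_pow₀ (by linarith) (by omega)
  have hu2 : 2 ≤ u := hn2.trans hnu
  have hu0 : 0 < u := by linarith
  have hE : Real.exp (-(d * Real.log n + Real.log (1 / δ))) = δ / u := by
    rw [one_div, Real.log_inv, neg_add, neg_neg, Real.exp_add, Real.exp_log hδ, Real.exp_neg,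
      Real.exp_nat_mul, Real.exp_log hn0]
    ring
  have hexp : ∀ m : ℕ, Real.exp (-(m : ℝ) * (d * Real.log n + Real.log (1 / δ)))
      = (δ / u) ^ m := fun m => by
    rw [← hE, ← Real.exp_nat_mul]
    ring_nf
  have h18 := hexp 18
  have h12 := hexp 12
  push_cast at h18 h12
  rw [h18, h12]
  have ha : ((n : ℝ) + 1) ^ d ≤ u ^ 2 := by
    rw [hu, ← pow_mul, mul_comm d, pow_mul]
    gcongr
    nlinarith
  have hb : ((n : ℝ) + n + 1) ^ d ≤ u ^ 3 := by
    rw [hu, ← pow_mul, mul_comm d, pow_mul]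
    gcongr
    nlinarith [mul_nonneg (sub_nonneg.2 hn2) (sub_nonneg.2 hn2), sq_nonneg (n : ℝ)]
  have hδm : ∀ m : ℕ, 2 ≤ m → (δ / u) ^ m ≤ δ ^ 2 / u ^ m := fun m hm => by
    rw [div_pow]
    refine div_le_div_of_nonneg_right ?_ (by positivity)
    exact pow_le_pow_of_le_one hδ.le hδ1.le hm
  push_cast
  have h1 : ((n : ℝ) + 1) ^ d * (((n : ℝ) + 1) ^ d * (n * 2)) * (δ / u) ^ 18 ≤ δ ^ 2 / 32 := by
    calc _ ≤ u ^ 2 * (u ^ 2 * (u * 2)) * (δ ^ 2 / u ^ 18) := by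
          gcongr
          exact hδm 18 (by norm_num)
      _ = δ ^ 2 * (2 / u ^ 13) := by field_simp
      _ ≤ δ ^ 2 * (2 / 2 ^ 13) := by gcongr
      _ ≤ _ := by nlinarith [sq_nonneg δ]
  have h2 : 2 * (((n : ℝ) + n + 1) ^ d * (δ / u) ^ 12) ≤ δ ^ 2 / 32 := by
    calc _ ≤ 2 * (u ^ 3 * (δ ^ 2 / u ^ 12)) := by
          gcongr
          exact hδm 12 (by norm_num)
      _ = δ ^ 2 * (2 / u ^ 9) := by field_simp
      _ ≤ δ ^ 2 * (2 / 2 ^ 9) := by gcongr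
      _ ≤ _ := by nlinarith [sq_nonneg δ]
  linarith

/-- For `s ≤ 1/2`, `1/(1 - s) ≤ 1 + 2 s`, and `k ≤ n` gives `s k/n ≤ 2 √(log (2/δ)/n)`; this is the
origin of `c₂ = 4`. -/
theorem cDelta_mul_le {d k n : ℕ} (hd : 1 ≤ d) (hk0 : 0 < k) (hk : k < n) {δ : ℝ} (hδ : 0 < δ)
    (hδ1 : δ < 1) (hs : Real.sqrt (4 / k * Real.log (2 / δ)) ≤ 1 / 2) :
    0 ≤ cDelta k δ * (k / n) ∧
      cDelta k δ * (k / n) ≤ k / n + 4 * Real.sqrt ((d + Real.log (1 / δ)) / n) := by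
  have hk' : (0 : ℝ) < k := by exact_mod_cast hk0
  have hn' : (0 : ℝ) < n := by exact_mod_cast hk0.trans hk
  have hkn : (k : ℝ) ≤ n := by exact_mod_cast hk.le
  have hℓ : 0 ≤ Real.log (2 / δ) := Real.log_nonneg (by rw [le_div_iff₀ hδ]; linarith)
  set s := Real.sqrt (4 / k * Real.log (2 / δ)) with hsdef
  have hs0 : 0 ≤ s := Real.sqrt_nonneg _
  have hpos : 0 < 1 - s := by linarith
  have hc : cDelta k δ ≤ 1 + 2 * s := by
    rw [cDelta, ← hsdef, inv_le_iff_one_le_mul₀ hpos]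
    nlinarith
  refine ⟨mul_nonneg (inv_nonneg.2 hpos.le) (by positivity), ?_⟩
  have hlog : Real.log (2 / δ) ≤ d + Real.log (1 / δ) := by
    rw [Real.log_div two_ne_zero hδ.ne', Real.log_div one_ne_zero hδ.ne', Real.log_one]
    have h2 : (1 : ℝ) ≤ d := by exact_mod_cast hd
    linarith [Real.log_two_lt_d9]
  have hsk : s * (k / n) ≤ 2 * Real.sqrt ((d + Real.log (1 / δ)) / n) := by
    have h2 : 2 * Real.sqrt ((d + Real.log (1 / δ)) / n)
        = Real.sqrt (4 * ((d + Real.log (1 / δ)) / n)) := by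
      rw [Real.sqrt_mul (by norm_num), show (4 : ℝ) = 2 ^ 2 by norm_num,
        Real.sqrt_sq two_pos.le]
    rw [h2]
    refine Real.le_sqrt_of_sq_le ?_
    rw [mul_pow, hsdef, Real.sq_sqrt (by positivity)]
    have : 4 / (k : ℝ) * Real.log (2 / δ) * (k / n) ^ 2
        = 4 * (Real.log (2 / δ) / n) * (k / n) := by field_simp
    rw [this]
    calc _ ≤ 4 * (Real.log (2 / δ) / n) * 1 := by
          gcongr
          exact (div_le_one hn').2 hkn
      _ ≤ _ := by rw [mul_one]; gcongr
  calc _ ≤ (1 + 2 * s) * ((k : ℝ) / n) := by gcongr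
    _ = k / n + 2 * (s * (k / n)) := by ring
    _ ≤ _ := by linarith

end Numeric

end ActiveKNN

end

/-- For universal constants `c₀, c₂`, if `η` is sufficiently smooth then with probability at least
`1 - δ² / 16` over `n` i.i.d. samples the effective decision boundary is contained in the estimated
hard region. The probability bound is stated as an outer-measure bound on the failure event, which
needs no measurability of that event and is the strong form of the claim. -/
theorem lemma1 :
    ∃ c₀ c₂ : ℝ, 0 < c₀ ∧ 0 < c₂ ∧
      ∀ (X : Type*) [MetricSpace X] [MeasurableSpace X] [BorelSpace X]
        (P : Measure (X × Bool)) [IsProbabilityMeasure P] [P.fst.IsOpenPosMeasure]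
        (η : X → ℝ) (_ : ActiveKNN.IsCondProb P η)
        (d : ℕ) (_ : ActiveKNN.vcDim (ActiveKNN.augBalls X) = d)
        (k n : ℕ) (_ : 0 < k) (_ : k < n)
        (δ : ℝ) (_ : 0 < δ) (_ : δ < 1)
        (α L : ℝ) (_ : 0 < α) (_ : 0 < L) (_ : ActiveKNN.IsSmooth P.fst η α L)
        (_ : 2 * L * ((k : ℝ) / n + c₂ * Real.sqrt ((d + Real.log (1 / δ)) / n)) ^ α
          ≤ ActiveKNN.marginUC c₀ d k n δ),
        ActiveKNN.sampleLaw P n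
          {S | ¬ ActiveKNN.effBoundary P.fst η (ActiveKNN.cDelta k δ * (k / n))
                (ActiveKNN.margin k δ)
              ⊆ ActiveKNN.hardRegion k (ActiveKNN.marginUC c₀ d k n δ) S}
          ≤ ENNReal.ofReal (δ ^ 2 / 16) := by
  refine ⟨20, 4, by norm_num, by norm_num, ?_⟩
  intro X _ _ _ P _ _ η hη d hd k n hk0 hk δ hδ hδ1 α L hα hL hsm hcond
  have hXne : Nonempty X := by
    have : Nonempty (X × Bool) := nonempty_of_isProbabilityMeasure P
    exact this.map Prod.fst
  have := ActiveKNN.secondCountable_of_isOpenPosMeasure P.fst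
  have hd1 := ActiveKNN.one_le_of_vcDim_eq hd
  have hn2 : 2 ≤ n := by omega
  have hk' : (1 : ℝ) ≤ k := by exact_mod_cast hk0
  have hk0' : (0 : ℝ) < k := by linarith
  have hlog := ActiveKNN.log_two_div_le hd1 hn2 hδ
  have hℓ : Real.log 2 ≤ Real.log (2 / δ) :=
    Real.log_le_log two_pos (by rw [le_div_iff₀ hδ]; linarith)
  have hlog2 := Real.log_two_gt_d9
  have hbound := ActiveKNN.union_bound_le hd1 hn2 hδ hδ1
  have hdef : ActiveKNN.marginUC 20 d k n δ
      = 20 * Real.sqrt ((d * Real.log n + Real.log (1 / δ)) / k) := rfl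
  set e := d * Real.log n + Real.log (1 / δ)
  set q := Real.sqrt (e / k)
  have he : 0.69 ≤ e := by linarith
  have hq : 0 < q := Real.sqrt_pos.2 (by positivity)
  have hq2 : q ^ 2 = e / k := Real.sq_sqrt (by positivity)
  have hkq : (k * q) ^ 2 = k * e := by
    rw [mul_pow, hq2]
    field_simp
  rw [hdef] at hcond ⊢
  -- If `60 q > 1/2` the hard region is everything, as votes lie in `[0,1]`. Otherwise `q ≤ 1/120`,
  -- which keeps `c_δ` bounded and gives `20 k q ≤ k`.
  rcases lt_or_ge (1 / 2) (3 * (20 * q)) with hbig | hsmall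
  · have hempty : {S | ¬ ActiveKNN.effBoundary P.fst η (ActiveKNN.cDelta k δ * (k / n))
        (ActiveKNN.margin k δ) ⊆ ActiveKNN.hardRegion k (20 * q) S}
        = (∅ : Set (ActiveKNN.Sample X n)) := by
      refine Set.eq_empty_of_forall_notMem fun S hS => hS fun x _ => ?_
      have hv := ActiveKNN.knnVote_mem_Icc hk S x
      show |ActiveKNN.knnVote k S x - 1 / 2| < 3 * (20 * q)
      exact lt_of_le_of_lt (abs_le.2 ⟨by linarith [hv.1], by linarith [hv.2]⟩) hbig
    rw [hempty, measure_empty]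
    exact zero_le
  have hs : Real.sqrt (4 / k * Real.log (2 / δ)) ≤ 2 * q := by
    refine Real.sqrt_le_iff.2 ⟨by positivity, ?_⟩
    rw [mul_pow, hq2, div_mul_eq_mul_div, ← mul_div_assoc]
    exact div_le_div_of_nonneg_right (by linarith) hk0'.le
  have hmargin : ActiveKNN.margin k δ ≤ q := by
    refine (min_le_right _ _).trans (Real.sqrt_le_sqrt ?_)
    rw [one_div_mul_eq_div]
    gcongr
  have hmargin0 : 0 ≤ ActiveKNN.margin k δ := le_min (by norm_num) (Real.sqrt_nonneg _)
  obtain ⟨hc0, hc⟩ := ActiveKNN.cDelta_mul_le hd1 hk0 hk hδ hδ1 (by linarith)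
  set A : ℝ := (k : ℝ) / n + 4 * Real.sqrt ((d + Real.log (1 / δ)) / n)
  have hkA : (k : ℝ) / n ≤ A := le_add_of_nonneg_right (by positivity)
  have hpow : ∀ p : ℝ, 0 ≤ p → p ≤ A → L * p ^ α ≤ 10 * q := fun p hp hpA => by
    have := mul_le_mul_of_nonneg_left (Real.rpow_le_rpow hp hpA hα.le) hL.le
    linarith
  -- As `(k q) ^ 2 = k e`, deviations `3 k q` and `20 k q` give exponents `-18 e` and `-12.5 e`, the
  -- latter relaxed to `-12 e`.
  have hlab := ActiveKNN.measure_labels_le (n := n) hη hd hk0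
    (show 0 < 3 * (k * q) by positivity)
  have hcnt := ActiveKNN.measure_sample_lowCount_le (n := n) (P := P) hd hk'
    (show 0 < 20 * (k * q) by positivity) (by nlinarith) (by rw [mul_pow, hkq]; nlinarith)
  rw [show -2 * ((3 * (k * q)) ^ 2 / k) = -18 * e by rw [mul_pow, hkq]; field_simp; norm_num] at hlab
  have hexp : Real.exp (-2 * ((20 * (k * q)) ^ 2 / (64 * k))) ≤ Real.exp (-12 * e) := by
    refine Real.exp_le_exp.2 ?_
    have : (20 * (k * q)) ^ 2 / (64 * k) = 25 / 4 * e := by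
      rw [mul_pow, hkq]; field_simp; norm_num
    rw [this]
    linarith
  calc _ ≤ ActiveKNN.sampleLaw P n (_ ∪ _) := measure_mono ?_
    _ ≤ _ := measure_union_le _ _
    _ ≤ _ := add_le_add hlab hcnt
    _ = _ := (ENNReal.ofReal_add (by positivity) (by positivity)).symm
    _ ≤ _ := ENNReal.ofReal_le_ofReal (le_trans (by gcongr) hbound)
  intro S hS
  by_contra hgood
  rw [Set.mem_union, not_or] at hgood
  refine hS fun x hx => ?_
  have hη1 := ActiveKNN.abs_sub_half_le_of_mem_effBoundary hη.measurable hη.mem_Icc hsm hα hL hc0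
    hmargin0 hx
  have hη2 := ActiveKNN.abs_knnVote_sub_le hη.mem_Icc hsm hα hL hk0 hk (t₁ := 3 * (k * q))
    (t₂ := 20 * (k * q)) (by positivity) S x
    (fun j hj => le_of_not_ge fun h => hgood.1 ⟨x, j, hj, h⟩)
    (fun r hr => not_lt.1 fun h => hgood.2 ⟨x, r, hr, h⟩)
  have h3 : (3 * (k * q) + 20 * (k * q)) / k = 23 * q := by field_simp; norm_num
  rw [h3] at hη2
  have h4 := hpow _ (by positivity) hkA
  have h5 := hpow _ hc0 hc
  show |ActiveKNN.knnVote k S x - 1 / 2| < 3 * (20 * q)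
  calc _ ≤ |ActiveKNN.knnVote k S x - η x| + |η x - 1 / 2| := abs_sub_le _ _ _
    -- Budget: `23 q` from the two events, `10 q` from each of the two smoothness terms and `q` from
    -- the margin, so `44 q < 60 q`.
    _ < _ := by linarith
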